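/- Consider the unit disk centred at the origin $O$ of the Euclidean plane, write $\mathcal P_\phi=(\cos\phi,\sin\phi)$, and let $\mathcal L_\phi$ be the tangent line of the disk at $\mathcal P_\phi$. An agent moves in the plane at unit speed, starting at $O$ at time $0$: its trajectory is a curve parametrized by arc length on $[0,\infty)$. A perimeter point $P$ is inspected from a position $A$ if no convex combination of $A$ and $P$ lies in the interior of the disk; the inspection time of $P$ is the first time at which the agent is at a position from which $P$ is inspected. Let $\mathcal A=\{\mathcal P_\phi:\phi\in[\alpha,\alpha+c]\}$ be an arc of length $c\in[0,2\pi]$. Over all trajectories that inspect every point of $\mathcal A$, the minimum of the worst-case inspection time $\sup_{P\in\mathcal A}(\text{inspection time of }P)$ exists and equals $$ T(c)=\begin{cases} \dfrac1{\cos(c/2)}, & 0\le c\le \frac{2\pi}3,\\[1ex] 1-2\cos c, & \frac{2\pi}3<c\le\frac{5\pi}6,\\[1ex] 1+\sqrt3+c-\frac{5\pi}6, & \frac{5\pi}6<c\le 2\pi . \end{cases} $$ For $\theta\in[0,\pi/2)$ put $A_0=\mathcal P_\alpha+\tan\theta\,\mathcal P_{\alpha+\pi/2}$, a point of $\mathcal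 L_\alpha$. If $c\le 5\pi/6$, the minimum is attained by a type-1 curve: for some $\theta$ with $c-\pi/2\le2\theta\le c$, the segment from $O$ to $A_0$ followed by the perpendicular segment from $A_0$ to $\mathcal L_{\alpha+c}$. If $c>5\pi/6$, the minimum is attained by a type-2 (Isbell-type) curve: for some $\theta$ with $2\theta\le c-\pi/2$, the segment from $O$ to $A_0$, the tangent segment from $A_0$ to $\mathcal P_{\alpha+2\theta}$, the counterclockwise perimeter arc from there to $\mathcal P_{\alpha+c-\pi/2}$, and the perpendicular segment from there to $\mathcal L_{\alpha+c}$. -/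

import Mathlib

open Set Metric
open scoped ENNReal

namespace DiskInspection

/-- The Euclidean plane; the unit disk is centred at its origin. -/
abbrev Plane : Type := EuclideanSpace ℝ (Fin 2)

/-- The point `(cos φ, sin φ)` of the perimeter of the unit disk. -/
noncomputable def perimeterPoint (φ : ℝ) : Plane := !₂[Real.cos φ, Real.sin φ]

/-- The arc of length `c` of the perimeter that starts at the angle `α`
and runs counterclockwise. -/
noncomputable def perimeterArc (α c : ℝ) : Set Plane :=
  perimeterPoint '' Icc α (α + c)

/-- An agent at `A` inspects the perimeter point `P` if no convex combination of `A` and `P`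
lies in the interior of the unit disk. -/
def Inspects (A P : Plane) : Prop :=
  Disjoint (segment ℝ A P) (ball (0 : Plane) 1)

/-- Trajectories of a unit-speed agent starting at the centre of the disk: `γ t` is the position
at time `t ≥ 0` (values at negative times are irrelevant), and the length of the curve traced
between times `s ≤ t` is `t - s`. -/
structure IsTrajectory (γ : ℝ → Plane) : Prop where
  start : γ 0 = 0
  unitSpeed : HasUnitSpeedOn γ (Ici 0)

/-- The trajectory `γ` inspects every point of `S`. -/
def InspectsAll (γ : ℝ → Plane) (S : Set Plane) : Prop :=
  ∀ P ∈ S, ∃ t : ℝ, 0 ≤ t ∧ Inspects (γ t) P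

/-- The inspection time of `P`: the infimum of the times at which `P` is inspected
(`⊤` if this never happens). -/
noncomputable def inspectionTime (γ : ℝ → Plane) (P : Plane) : ℝ≥0∞ :=
  ⨅ (t : ℝ) (_ : 0 ≤ t ∧ Inspects (γ t) P), ENNReal.ofReal t

/-- The worst-case inspection time over the points of `S`. -/
noncomputable def worstCaseTime (γ : ℝ → Plane) (S : Set Plane) : ℝ≥0∞ :=
  ⨆ P ∈ S, inspectionTime γ P

/-- The worst-case inspection times of all the trajectories that inspect every point of `S`. -/
def worstCaseTimes (S : Set Plane) : Set ℝ≥0∞ :=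
  {T | ∃ γ : ℝ → Plane, IsTrajectory γ ∧ InspectsAll γ S ∧ worstCaseTime γ S = T}

/-- From time `s` on, `γ` traverses the segment from `X` to `Y` at unit speed
(it is at `Y` at time `s + dist X Y`). -/
def TraversesSegment (γ : ℝ → Plane) (s : ℝ) (X Y : Plane) : Prop :=
  ∀ t ∈ Icc s (s + dist X Y), γ t = AffineMap.lineMap X Y ((t - s) / dist X Y)

/-- From time `s` on, `γ` traverses counterclockwise, at unit speed, the arc of the perimeter
between the angles `φ` and `ψ` (it is at the end of the arc at time `s + (ψ - φ)`). -/
def TraversesArc (γ : ℝ → Plane) (s φ ψ : ℝ) : Prop :=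
  ∀ t ∈ Icc s (s + (ψ - φ)), γ t = perimeterPoint (φ + (t - s))

/-- The point at signed distance `tan θ` from `perimeterPoint α`, counterclockwise, on the tangent
line there: for `α = 0` it is `(1, tan θ)`. -/
noncomputable def deploymentPoint (α θ : ℝ) : Plane :=
  perimeterPoint α + Real.tan θ • perimeterPoint (α + Real.pi / 2)

/-- The foot of the perpendicular from `A` to the tangent line of the disk at the angle `φ`. -/
noncomputable def tangentFoot (φ : ℝ) (A : Plane) : Plane :=
  A + (1 - inner ℝ A (perimeterPoint φ)) • perimeterPoint φ

/-- Type-1 curve with deployment angle `θ`, for the arc of length `c` starting at the angle `α`: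
the segment from the centre to the deployment point `A₀` on the tangent line at the first end of
the arc, then the perpendicular from `A₀` to the tangent line at the other end. -/
structure IsType1Curve (α c θ : ℝ) (γ : ℝ → Plane) : Prop where
  nonneg : 0 ≤ θ
  lt_pi_div_two : θ < Real.pi / 2
  le_half : θ ≤ c / 2
  le_two_mul : c - Real.pi / 2 ≤ 2 * θ
  deploy : TraversesSegment γ 0 0 (deploymentPoint α θ)
  perpendicular :
    TraversesSegment γ (dist 0 (deploymentPoint α θ))
      (deploymentPoint α θ) (tangentFoot (α + c) (deploymentPoint α θ))

/-- Type-2 curve with deployment angle `θ`, for the arc of length `c` starting at the angle `α`: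
the segment from the centre to the deployment point `A₀` on the tangent line at the first end of
the arc, the tangent segment from `A₀` to the perimeter point at angle `α + 2θ`, the arc of the
perimeter from there to the angle `α + c - π/2`, and finally the perpendicular to the tangent line
at the other end of the arc. -/
structure IsType2Curve (α c θ : ℝ) (γ : ℝ → Plane) : Prop where
  nonneg : 0 ≤ θ
  lt_pi_div_two : θ < Real.pi / 2
  two_mul_le : 2 * θ ≤ c - Real.pi / 2
  deploy : TraversesSegment γ 0 0 (deploymentPoint α θ)
  tangent :
    TraversesSegment γ (dist 0 (deploymentPoint α θ))
      (deploymentPoint α θ) (perimeterPoint (α + 2 * θ))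
  arc :
    TraversesArc γ
      (dist 0 (deploymentPoint α θ) +
        dist (deploymentPoint α θ) (perimeterPoint (α + 2 * θ)))
      (α + 2 * θ) (α + c - Real.pi / 2)
  perpendicular :
    TraversesSegment γ
      (dist 0 (deploymentPoint α θ) +
        dist (deploymentPoint α θ) (perimeterPoint (α + 2 * θ)) +
        (c - Real.pi / 2 - 2 * θ))
      (perimeterPoint (α + c - Real.pi / 2))
      (tangentFoot (α + c) (perimeterPoint (α + c - Real.pi / 2)))

/-- The claimed optimal worst-case inspection time of an arc of length `c`. -/
noncomputable def optimalTime (c : ℝ) : ℝ :=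
  if c ≤ 2 * Real.pi / 3 then 1 / Real.cos (c / 2)
  else if c ≤ 5 * Real.pi / 6 then 1 - 2 * Real.cos c
  else 1 + Real.sqrt 3 + c - 5 * Real.pi / 6

end DiskInspection

/-! A position z inspects the direction φ exactly when its coordinate along (cos φ, sin φ) is at
least 1 (`inspects_iff`). For c ≤ 5π/6 the lower bound uses only the two ends of the arc: if A
inspects one and B the other, ‖A‖ + |AB| is bounded below by projecting each term on a suitable
direction (`one_div_cos_le`, `one_sub_two_mul_cos_le`).

For longer arcs, suppose first that the positions inspect consecutive intervals from left to right,
starting at the angle a. The bound is then a calibration (`FChain.le_cost`): the cost is at least √3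
+ s - (a + π/3) + coord z (s + π/2). Inspecting a from the first position accounts for √3, a move
pays for the change of the coordinate, and while one position inspects the directions near s the
coordinate falls at rate at least 1 in s, which offsets the term s. At s = e - π/2 the last position
has coord z e ≥ 1, and the claimed value comes out.

A general trajectory is reduced to this case. By compactness finitely many positions suffice, up to
a dilation close to 1 (`IsTrajectory.lower_bound_of_arc`). Once superfluous ones are dropped, each
has a private direction (`exists_privates`), and sorted by these directions they tile the arc, or
the whole circle (`Privates.exists_tiling_of_covering`). In a shortest order of visit the visited
and unvisited ranks never interlace, since two tour edges with interlaced private directions cross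
and could be exchanged at a gain (`Privates.nonInterlacing`). So the visited ranks always form a
cyclic interval. While it grows at both ends without wrapping around, reflections in bisectors make
the sweep monotone without lengthening it (`chain_of_growing`). What remains is the jump from one
end of the arc to ranks near the other: either a further reflection makes everything monotone, or
the tour goes on around the disk past the uninspected gap, and a calibration whose weight is
constant on the gap gives the same bound (`lower_bound_of_crossing_gap`).

The upper bounds are explicit curves, with the deployment angle chosen to minimise their length. -/

namespace DiskInspection

/-! ### Coordinates along a direction -/

/-- The coordinate of `z` along the direction `(cos φ, sin φ)`. -/
noncomputable def coord (z : Plane) (φ : ℝ) : ℝ := z 0 * Real.cos φ + z 1 * Real.sin φ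

theorem inner_perimeterPoint (z : Plane) (φ : ℝ) : inner ℝ z (perimeterPoint φ) = coord z φ := by
  simp [perimeterPoint, coord, PiLp.inner_apply, Fin.sum_univ_two]
  ring

@[simp] theorem coord_zero (φ : ℝ) : coord 0 φ = 0 := by simp [coord]

theorem coord_add_left (z w : Plane) (φ : ℝ) : coord (z + w) φ = coord z φ + coord w φ := by
  simp [coord]; ring

theorem coord_sub_left (z w : Plane) (φ : ℝ) : coord (z - w) φ = coord z φ - coord w φ := by
  simp [coord]; ring

theorem coord_smul (r : ℝ) (z : Plane) (φ : ℝ) : coord (r • z) φ = r * coord z φ := by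
  simp [coord]; ring

theorem coord_perimeterPoint (φ ψ : ℝ) : coord (perimeterPoint φ) ψ = Real.cos (φ - ψ) := by
  simp [coord, perimeterPoint, Real.cos_sub]

theorem coord_add_pi (z : Plane) (φ : ℝ) : coord z (φ + Real.pi) = -coord z φ := by
  simp [coord]; ring

theorem coord_add_two_pi (z : Plane) (φ : ℝ) : coord z (φ + 2 * Real.pi) = coord z φ := by
  simp [coord]

theorem coord_sub_two_pi (z : Plane) (φ : ℝ) : coord z (φ - 2 * Real.pi) = coord z φ := by
  simp [coord]

/-- Expansion in the orthonormal frame at angle `m`. -/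
theorem coord_add_right (z : Plane) (m s : ℝ) :
    coord z (m + s) = coord z m * Real.cos s + coord z (m + Real.pi / 2) * Real.sin s := by
  simp [coord, Real.cos_add, Real.sin_add]; ring

theorem coord_sub_right (z : Plane) (m s : ℝ) :
    coord z (m - s) = coord z m * Real.cos s - coord z (m + Real.pi / 2) * Real.sin s := by
  simp [coord, Real.cos_add, Real.sin_add, Real.cos_sub, Real.sin_sub]; ring

theorem norm_sq_eq (z : Plane) (m : ℝ) :
    ‖z‖ ^ 2 = coord z m ^ 2 + coord z (m + Real.pi / 2) ^ 2 := by
  simp only [EuclideanSpace.norm_sq_eq, Fin.sum_univ_two, coord, Real.norm_eq_abs, sq_abs,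
    Real.cos_add_pi_div_two, Real.sin_add_pi_div_two]
  linear_combination (-(z 0) ^ 2 - z 1 ^ 2) * Real.sin_sq_add_cos_sq m

theorem dist_sq_eq (z w : Plane) (m : ℝ) :
    dist z w ^ 2 = (coord z m - coord w m) ^ 2 +
      (coord z (m + Real.pi / 2) - coord w (m + Real.pi / 2)) ^ 2 := by
  rw [dist_eq_norm, norm_sq_eq _ m, coord_sub_left, coord_sub_left]

theorem coord_le_norm (z : Plane) (φ : ℝ) : coord z φ ≤ ‖z‖ :=
  (abs_le_of_sq_le_sq' (by
    rw [norm_sq_eq z φ]; nlinarith [sq_nonneg (coord z (φ + Real.pi / 2))]) (norm_nonneg z)).2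

theorem coord_sub_le_dist (z w : Plane) (φ : ℝ) : coord z φ - coord w φ ≤ dist z w := by
  rw [dist_eq_norm, ← coord_sub_left]; exact coord_le_norm _ _

theorem continuous_coord (z : Plane) : Continuous (coord z) := by
  unfold coord; fun_prop

theorem ext_coord {z w : Plane} (m : ℝ) (h₁ : coord z m = coord w m)
    (h₂ : coord z (m + Real.pi / 2) = coord w (m + Real.pi / 2)) : z = w := by
  rw [← dist_eq_zero, ← sq_eq_zero_iff, dist_sq_eq z w m, h₁, h₂]; ring

/-- If two directions less than `π` apart have coordinate at least `h ≥ 0`, so have the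
directions in between. -/
theorem le_coord_of_mem_Icc {z : Plane} {a b h φ : ℝ} (hh : 0 ≤ h) (hab : b - a < Real.pi)
    (ha : h ≤ coord z a) (hb : h ≤ coord z b) (h₁ : a ≤ φ) (h₂ : φ ≤ b) : h ≤ coord z φ := by
  rcases eq_or_lt_of_le (h₁.trans h₂) with hab' | hab'
  · rwa [le_antisymm (hab' ▸ h₂) h₁]
  have hs : 0 < Real.sin (b - a) := Real.sin_pos_of_pos_of_lt_pi (by linarith) hab
  have hx : 0 ≤ Real.sin (b - φ) := Real.sin_nonneg_of_nonneg_of_le_pi (by linarith) (by linarith)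
  have hy : 0 ≤ Real.sin (φ - a) := Real.sin_nonneg_of_nonneg_of_le_pi (by linarith) (by linarith)
  -- The unit vector at φ is a combination of those at a and b with nonnegative weights, whose sum
  -- is at least 1 by subadditivity of the sine.
  have key : Real.sin (b - a) * coord z φ =
      Real.sin (b - φ) * coord z a + Real.sin (φ - a) * coord z b := by
    simp only [coord, Real.sin_sub]
    ring
  have hsum : Real.sin (b - a) ≤ Real.sin (b - φ) + Real.sin (φ - a) := by
    have : b - a = (b - φ) + (φ - a) := by ring
    rw [this, Real.sin_add]
    nlinarith [Real.cos_le_one (b - φ), Real.cos_le_one (φ - a)]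
  have : Real.sin (b - a) * h ≤ Real.sin (b - a) * coord z φ := by
    rw [key]; nlinarith [mul_le_mul_of_nonneg_left ha hx, mul_le_mul_of_nonneg_left hb hy]
  exact le_of_mul_le_mul_left this hs

/-- `Covers a e z` says that from `z` all the directions between `a` and `e` are inspected. -/
def Covers (a e : ℝ) (z : Plane) : Prop := ∀ φ, a ≤ φ → φ ≤ e → 1 ≤ coord z φ

theorem Covers.mono {a e a' e' : ℝ} {z : Plane} (h : Covers a e z) (ha : a ≤ a') (he : e' ≤ e) :
    Covers a' e' z := fun φ h₁ h₂ => h φ (ha.trans h₁) (h₂.trans he)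

theorem Covers.union {a e e' : ℝ} {z : Plane} (h : Covers a e z) (h' : Covers e e' z) :
    Covers a e' z := fun φ h₁ h₂ => (le_total φ e).elim (h φ h₁) fun h₃ => h' φ h₃ h₂

theorem covers_of_lt_pi {a e : ℝ} {z : Plane} (hae : e - a < Real.pi) (ha : 1 ≤ coord z a)
    (he : 1 ≤ coord z e) : Covers a e z := fun _ h₁ h₂ =>
  le_coord_of_mem_Icc zero_le_one hae ha he h₁ h₂

theorem covers_singleton {a : ℝ} {z : Plane} (h : 1 ≤ coord z a) : Covers a a z := fun φ h₁ h₂ => by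
  rwa [le_antisymm h₂ h₁]

theorem not_sees_opposite {a : ℝ} {z : Plane} (ha : 1 ≤ coord z a)
    (hb : 1 ≤ coord z (a + Real.pi)) : False := by
  rw [coord_add_pi] at hb; linarith

/-- Two inspected directions: either the arc between them is inspected or the complementary one. -/
theorem covers_or_covers_compl {a e : ℝ} {z : Plane} (ha : 1 ≤ coord z a) (he : 1 ≤ coord z e) :
    Covers a e z ∨ Covers e (a + 2 * Real.pi) z := by
  rcases lt_trichotomy (e - a) Real.pi with hlt | heq | hgt
  · exact Or.inl (covers_of_lt_pi hlt ha he)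
  · exact (not_sees_opposite ha (by rwa [← heq, add_sub_cancel])).elim
  · exact Or.inr (covers_of_lt_pi (by linarith) he (by rwa [coord_add_two_pi]))

/-- If `m + δ` is inspected from a point on the other side of the axis of direction `m`, then
so is the whole arc `[m - δ, m + δ]`, or the whole complementary arc. -/
theorem covers_of_axis {m δ : ℝ} {z : Plane} (h₀ : 0 ≤ δ) (hπ : δ ≤ Real.pi)
    (hz : 1 ≤ coord z (m + δ)) (hneg : coord z (m + Real.pi / 2) ≤ 0) :
    (δ < Real.pi / 2 ∧ Covers (m - δ) (m + δ) z) ∨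
      (Real.pi / 2 < δ ∧ Covers (m + δ) (m - δ + 2 * Real.pi) z) := by
  have hs := Real.sin_nonneg_of_nonneg_of_le_pi h₀ hπ
  have hz' : 1 ≤ coord z (m - δ) := by
    rw [coord_add_right] at hz
    rw [coord_sub_right]
    nlinarith
  rcases lt_trichotomy δ (Real.pi / 2) with hlt | rfl | hgt
  · exact Or.inl ⟨hlt, covers_of_lt_pi (by linarith) hz' hz⟩
  · linarith
  · exact Or.inr ⟨hgt, covers_of_lt_pi (by linarith) hz (by rwa [coord_add_two_pi])⟩

theorem hasDerivAt_coord_add_pi_div_two (z : Plane) (x : ℝ) :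
    HasDerivAt (fun s => coord z (s + Real.pi / 2)) (-coord z x) x := by
  have h2 : HasDerivAt (fun s : ℝ => s + Real.pi / 2) 1 x := (hasDerivAt_id x).add_const _
  have h3 := ((Real.hasDerivAt_cos (x + Real.pi / 2)).comp x h2).const_mul (z 0)
  have h4 := ((Real.hasDerivAt_sin (x + Real.pi / 2)).comp x h2).const_mul (z 1)
  refine (h3.add h4).congr_deriv ?_
  rw [Real.sin_add_pi_div_two, Real.cos_add_pi_div_two, coord]
  ring

/-- While `coord z` is at least `r`, the sum `coord z (s + π / 2) + r * s` decreases. -/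
theorem coord_add_pi_div_two_add_le {s t r : ℝ} {z : Plane} (hst : s ≤ t)
    (h : ∀ φ, s ≤ φ → φ ≤ t → r ≤ coord z φ) :
    coord z (t + Real.pi / 2) + r * t ≤ coord z (s + Real.pi / 2) + r * s := by
  have hd : ∀ x, HasDerivAt (fun s => coord z (s + Real.pi / 2) + r * s) (-coord z x + r * 1) x :=
    fun x => (hasDerivAt_coord_add_pi_div_two z x).add ((hasDerivAt_id x).const_mul r)
  have := antitoneOn_of_deriv_nonpos (convex_Icc s t)
    (fun x _ => (hd x).continuousAt.continuousWithinAt)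
    (fun x _ => (hd x).differentiableAt.differentiableWithinAt)
    (fun x hx => by
      rw [interior_Icc] at hx
      rw [(hd x).deriv]
      linarith [h x hx.1.le hx.2.le])
  exact this (left_mem_Icc.2 hst) (right_mem_Icc.2 hst) hst

/-! ### Reflections -/

/-- The reflection in the line through the origin with direction `m`. -/
noncomputable def refl (m : ℝ) (z : Plane) : Plane :=
  !₂[coord z (2 * m), coord z (2 * m - Real.pi / 2)]

@[simp] theorem coord_refl (m φ : ℝ) (z : Plane) : coord (refl m z) φ = coord z (2 * m - φ) := by
  simp [refl, coord, Real.cos_sub, Real.sin_sub]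
  ring

@[simp] theorem refl_refl (m : ℝ) (z : Plane) : refl m (refl m z) = z :=
  ext_coord 0 (by simp) (by simp)

theorem norm_refl (m : ℝ) (z : Plane) : ‖refl m z‖ = ‖z‖ := by
  rw [← sq_eq_sq₀ (norm_nonneg _) (norm_nonneg _), norm_sq_eq _ m, norm_sq_eq z m]
  rw [coord_refl, coord_refl]
  have : 2 * m - (m + Real.pi / 2) + Real.pi = m + Real.pi / 2 := by ring
  rw [← this, coord_add_pi]
  ring_nf

theorem refl_sub (m : ℝ) (z w : Plane) : refl m z - refl m w = refl m (z - w) :=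
  ext_coord 0 (by simp [coord_sub_left]) (by simp [coord_sub_left])

@[simp] theorem dist_refl_refl (m : ℝ) (z w : Plane) : dist (refl m z) (refl m w) = dist z w := by
  rw [dist_eq_norm, refl_sub, norm_refl, dist_eq_norm]

@[simp] theorem refl_zero (m : ℝ) : refl m 0 = 0 :=
  ext_coord 0 (by simp) (by simp)

theorem coord_refl_perp (m : ℝ) (z : Plane) :
    coord (refl m z) (m + Real.pi / 2) = -coord z (m + Real.pi / 2) := by
  rw [coord_refl, ← coord_add_pi, ← coord_sub_two_pi z (m + _ + _)]
  ring_nf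

/-- Reflecting a point to the side of the axis where another point lies brings it closer. -/
theorem dist_refl_le {m : ℝ} {z w : Plane}
    (h : coord z (m + Real.pi / 2) * coord w (m + Real.pi / 2) ≤ 0) :
    dist (refl m z) w ≤ dist z w := by
  refine (abs_le_of_sq_le_sq' ?_ dist_nonneg).2
  rw [dist_sq_eq _ _ m, dist_sq_eq z w m, coord_refl_perp, coord_refl]
  ring_nf at h ⊢
  nlinarith

theorem Covers.refl {a e m : ℝ} {z : Plane} (h : Covers a e z) :
    Covers (2 * m - e) (2 * m - a) (refl m z) := fun φ h₁ h₂ => by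
  rw [coord_refl]; exact h _ (by linarith) (by linarith)

theorem covers_add_two_pi {a e : ℝ} {z : Plane} (h : Covers a e z) :
    Covers (a + 2 * Real.pi) (e + 2 * Real.pi) z := fun φ h₁ h₂ => by
  rw [← coord_sub_two_pi]; exact h _ (by linarith) (by linarith)

theorem covers_of_axis' {m δ : ℝ} {z : Plane} (h₀ : 0 ≤ δ) (hπ : δ ≤ Real.pi)
    (hz : 1 ≤ coord z (m - δ)) (hpos : 0 ≤ coord z (m + Real.pi / 2)) :
    (δ < Real.pi / 2 ∧ Covers (m - δ) (m + δ) z) ∨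
      (Real.pi / 2 < δ ∧ Covers (m + δ) (m - δ + 2 * Real.pi) z) := by
  have h := covers_of_axis (m := m) (z := refl m z) h₀ hπ
    (by rw [coord_refl]; convert hz using 2; ring) (by rw [coord_refl_perp]; linarith)
  rcases h with ⟨h₁, h₂⟩ | ⟨h₁, h₂⟩
  · exact Or.inl ⟨h₁, by simpa using (h₂.refl (m := m)).mono (by linarith) (by linarith)⟩
  · refine Or.inr ⟨h₁, ?_⟩
    have h₃ := covers_add_two_pi (h₂.refl (m := m))
    rw [refl_refl] at h₃
    exact h₃.mono (by linarith) (by linarith)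

/-! ### Chains of points inspecting consecutive arcs -/

/-- `FChain G w a e p C`: points `p₁, …, pₖ = p` are good (in the sense of `G`) for consecutive
intervals which tile `[a, e]` from left to right, and `w * ‖p₁‖` plus the length of the polygonal
line through the points is at most `C`. -/
inductive FChain (G : ℝ → ℝ → Plane → Prop) (w a : ℝ) : ℝ → Plane → ℝ → Prop
  | single {e : ℝ} {p : Plane} {C : ℝ} (hae : a ≤ e) (hpa : 1 ≤ coord p a) (hp : G a e p)
      (hC : w * ‖p‖ ≤ C) : FChain G w a e p C
  | snoc {e e' : ℝ} {p q : Plane} {C C' : ℝ} (h : FChain G w a e p C) (hee : e ≤ e')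
      (hq : G e e' q) (hC : C + dist p q ≤ C') : FChain G w a e' q C'

/-- `BChain w e a p C`: points `p₁, …, pₖ = p` inspect consecutive intervals which tile `[a, e]`
from right to left, and `w * ‖p₁‖` plus the length of the polygonal line through the points is at
most `C`. -/
inductive BChain (w e : ℝ) : ℝ → Plane → ℝ → Prop
  | single {a : ℝ} {p : Plane} {C : ℝ} (hae : a ≤ e) (hp : Covers a e p)
      (hC : w * ‖p‖ ≤ C) : BChain w e a p C
  | snoc {a a' : ℝ} {p q : Plane} {C C' : ℝ} (h : BChain w e a p C) (haa : a' ≤ a)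
      (hq : Covers a' a q) (hC : C + dist p q ≤ C') : BChain w e a' q C'

section Chains

variable {G : ℝ → ℝ → Plane → Prop} {w a e e' m C C' : ℝ} {p q : Plane}

theorem FChain.single_covers (hae : a ≤ e) (hp : Covers a e p) (hC : w * ‖p‖ ≤ C) :
    FChain Covers w a e p C := .single hae (hp a le_rfl hae) hp hC

theorem FChain.le (h : FChain G w a e p C) : a ≤ e := by
  induction h with
  | single => assumption
  | snoc _ _ _ _ ih => exact ih.trans ‹_›

theorem FChain.mono_cost (h : FChain G w a e p C) (hC : C ≤ C') : FChain G w a e p C' := by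
  cases h with
  | single h₁ h₂ h₃ h₄ => exact .single h₁ h₂ h₃ (h₄.trans hC)
  | snoc h₁ h₂ h₃ h₄ => exact .snoc h₁ h₂ h₃ (h₄.trans hC)

theorem FChain.mono_good {G' : ℝ → ℝ → Plane → Prop} (h : FChain G w a e p C)
    (hG : ∀ s t z, a ≤ s → s ≤ t → t ≤ e → G s t z → G' s t z) : FChain G' w a e p C := by
  induction h with
  | single h₁ h₂ h₃ h₄ => exact .single h₁ h₂ (hG _ _ _ le_rfl h₁ le_rfl h₃) h₄
  | snoc h₁ h₂ h₃ h₄ ih =>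
    exact .snoc (ih fun s t z i₁ i₂ i₃ => hG s t z i₁ i₂ (i₃.trans h₂)) h₂
      (hG _ _ _ h₁.le h₂ le_rfl h₃) h₄

theorem FChain.one_le_coord (h : FChain Covers w a e p C) : 1 ≤ coord p e := by
  cases h with
  | single h₁ h₂ h₃ h₄ => exact h₃ _ h₁ le_rfl
  | snoc h₁ h₂ h₃ h₄ => exact h₃ _ h₂ le_rfl

theorem FChain.norm_le (h : FChain G w a e p C) (hw : 0 ≤ w) (hw₁ : w ≤ 1) : w * ‖p‖ ≤ C := by
  induction h with
  | single => assumption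
  | @snoc e e' p q C C' h₁ h₂ h₃ h₄ ih =>
    have h : ‖q‖ ≤ ‖p‖ + dist p q := by
      rw [dist_eq_norm, norm_sub_rev]; exact norm_le_insert' q p
    nlinarith [dist_nonneg (x := p) (y := q)]

theorem BChain.refl (h : BChain w e a p C) (m : ℝ) :
    FChain Covers w (2 * m - e) (2 * m - a) (refl m p) C := by
  induction h with
  | single h₁ h₂ h₃ => exact .single_covers (by linarith) h₂.refl (by rwa [norm_refl])
  | snoc h₁ h₂ h₃ h₄ ih => exact .snoc ih (by linarith) h₃.refl (by rwa [dist_refl_refl])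

theorem FChain.refl (h : FChain Covers w a e p C) (m : ℝ) :
    BChain w (2 * m - a) (2 * m - e) (refl m p) C := by
  induction h with
  | single h₁ h₂ h₃ h₄ => exact .single (by linarith) h₃.refl (by rwa [norm_refl])
  | snoc h₁ h₂ h₃ h₄ ih => exact .snoc ih (by linarith) h₃.refl (by rwa [dist_refl_refl])

theorem BChain.le (h : BChain w e a p C) : a ≤ e := by
  have := (h.refl 0).le
  linarith

theorem BChain.one_le_coord (h : BChain w e a p C) : 1 ≤ coord p a := by
  simpa using (h.refl 0).one_le_coord

theorem BChain.norm_le (h : BChain w e a p C) (hw : 0 ≤ w) (hw₁ : w ≤ 1) : w * ‖p‖ ≤ C := by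
  simpa [norm_refl] using (h.refl 0).norm_le hw hw₁

theorem BChain.add_two_pi (h : BChain w e a p C) :
    BChain w (e + 2 * Real.pi) (a + 2 * Real.pi) p C := by
  induction h with
  | single h₁ h₂ h₃ => exact .single (by linarith) (covers_add_two_pi h₂) h₃
  | snoc h₁ h₂ h₃ h₄ ih => exact .snoc ih (by linarith) (covers_add_two_pi h₃) h₄

/-- A backward chain followed by a point inspecting an interval at the far end can be replaced by
a forward chain that is not longer, unless one of the two points at the junction inspects the
complementary arc. -/
theorem BChain.switch (h : BChain w e a p C) (hw : 0 ≤ w) (hw₁ : w ≤ 1) (hee : e ≤ e')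
    (hlen : e ≤ a + 2 * Real.pi) (hq : Covers e e' q) :
    FChain Covers w a e' q (C + dist p q) ∨ Covers e (a + 2 * Real.pi) p ∨
      Covers e (a + 2 * Real.pi) q := by
  have hae := h.le
  -- Take the bisector m of [a, e]. If p lies on the side of e, or q on the side of a, that point
  -- alone inspects [a, e] or its complement. Otherwise reflecting the whole chain in the bisector
  -- turns it forward and brings p nearer to q.
  obtain ⟨m, hm⟩ : ∃ m, m = (a + e) / 2 := ⟨_, rfl⟩
  obtain ⟨δ, hδ⟩ : ∃ δ, δ = (e - a) / 2 := ⟨_, rfl⟩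
  have ha : m - δ = a := by rw [hm, hδ]; ring
  have he : m + δ = e := by rw [hm, hδ]; ring
  rcases le_total 0 (coord p (m + Real.pi / 2)) with hp | hp
  · rcases covers_of_axis' (m := m) (δ := δ) (by linarith) (by linarith)
      (by rw [ha]; exact h.one_le_coord) hp with ⟨-, h₁⟩ | ⟨-, h₁⟩
    · rw [ha, he] at h₁
      exact Or.inl (.snoc (.single_covers hae h₁ (h.norm_le hw hw₁)) hee hq le_rfl)
    · rw [ha, he] at h₁
      exact Or.inr (Or.inl h₁)
  rcases le_total 0 (coord q (m + Real.pi / 2)) with hq' | hq'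
  · refine Or.inl (.snoc (p := DiskInspection.refl m p) (C := C) (e := e) ?_ hee hq ?_)
    · convert h.refl m using 1 <;> linarith
    · gcongr
      exact dist_refl_le (mul_nonpos_of_nonpos_of_nonneg hp hq')
  · rcases covers_of_axis (m := m) (δ := δ) (by linarith) (by linarith)
      (by rw [he]; exact hq e le_rfl hee) hq' with ⟨-, h₁⟩ | ⟨-, h₁⟩
    · rw [ha, he] at h₁
      refine Or.inl (.single_covers (hae.trans hee) (h₁.union hq) ?_)
      have h₂ : ‖q‖ ≤ ‖p‖ + dist p q := by
        rw [dist_eq_norm, norm_sub_rev]; exact norm_le_insert' q p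
      nlinarith [h.norm_le hw hw₁, dist_nonneg (x := p) (y := q)]
    · rw [ha, he] at h₁
      exact Or.inr (Or.inr h₁)

theorem FChain.switch {a' : ℝ} (h : FChain Covers w a e p C) (hw : 0 ≤ w) (hw₁ : w ≤ 1)
    (haa : a' ≤ a) (hlen : e ≤ a + 2 * Real.pi) (hq : Covers a' a q) :
    BChain w e a' q (C + dist p q) ∨ Covers e (a + 2 * Real.pi) p ∨
      Covers e (a + 2 * Real.pi) q := by
  have hr : ∀ z, Covers (2 * 0 - a) (2 * 0 - e + 2 * Real.pi) (DiskInspection.refl 0 z) →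
      Covers e (a + 2 * Real.pi) z := fun z hz => by
    have h₃ := covers_add_two_pi (hz.refl (m := 0))
    rw [refl_refl] at h₃
    exact h₃.mono (by linarith) (by linarith)
  rcases (h.refl 0).switch hw hw₁ (e' := 2 * 0 - a') (q := DiskInspection.refl 0 q)
    (by linarith) (by linarith) hq.refl with h₁ | h₁ | h₁
  · exact Or.inl (by simpa using h₁.refl 0)
  · exact Or.inr (Or.inl (hr _ h₁))
  · exact Or.inr (Or.inr (hr _ h₁))

/-- Continuing a forward chain along a backward chain traversed from its end. -/
theorem FChain.append {c C₁ C₂ : ℝ} {Z : Plane} (hB : BChain 0 c e Z C₂)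
    (hG : ∀ s t z, e ≤ s → s ≤ t → Covers s t z → G s t z) (hF : FChain G w a e Z C₁) :
    ∃ p, FChain G w a c p (C₁ + C₂) ∧ 1 ≤ coord p c := by
  induction hB generalizing C₁ with
  | @single e p C h₁ h₂ h₃ =>
    exact ⟨p, .snoc hF h₁ (hG _ _ _ le_rfl h₁ h₂) (by rw [dist_self]; linarith), h₂ c h₁ le_rfl⟩
  | @snoc e e' p q C C' h₁ h₂ h₃ h₄ ih =>
    obtain ⟨r, hr, hr'⟩ := ih (C₁ := C₁ + dist p q)
      (fun s t z i₁ i₂ i₃ => hG s t z (h₂.trans i₁) i₂ i₃)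
      -- The junction point is repeated at no cost to inspect its own interval; then p is added for
      -- the degenerate interval {e}, which is where the induction hypothesis takes over.
      (.snoc (.snoc hF h₂ (hG _ _ _ le_rfl h₂ h₃) le_rfl) le_rfl
        (hG _ _ _ h₂ le_rfl (covers_singleton h₁.one_le_coord))
        (by rw [dist_self, dist_comm p q, add_zero]))
    exact ⟨r, hr.mono_cost (by linarith), hr'⟩

/-- `z` is good for `[s, t]` with respect to the weight `ω` if `coord z (x + π / 2) + ω x`
decreases there. -/
def Good (ω : ℝ → ℝ) (s t : ℝ) (z : Plane) : Prop := ∀ x y, s ≤ x → x ≤ y → y ≤ t →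
  coord z (y + Real.pi / 2) + ω y ≤ coord z (x + Real.pi / 2) + ω x

theorem Covers.good {ω : ℝ → ℝ} {s t : ℝ} {z : Plane} (h : Covers s t z)
    (hω : ∀ x y, s ≤ x → x ≤ y → y ≤ t → ω y - ω x ≤ y - x) : Good ω s t z := by
  intro x y h₁ h₂ h₃
  have := coord_add_pi_div_two_add_le (z := z) (r := 1) h₂
    fun φ i₁ i₂ => h φ (h₁.trans i₁) (i₂.trans h₃)
  linarith [hω x y h₁ h₂ h₃]

/-- The vector at a + π/6 is the one at a + 5π/6 plus √3 times the one at a. Here π/6 is the optimal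
deployment angle, and a + π/3 is the angle of the corresponding tangency point, where the
calibration starts. -/
theorem cos_pi_div_six_mul (p : Plane) (a : ℝ) :
    coord p (a + Real.pi / 6) =
      coord p (a + Real.pi / 3 + Real.pi / 2) + Real.sqrt 3 * coord p a := by
  have h : a + Real.pi / 3 + Real.pi / 2 = a - Real.pi / 6 + Real.pi := by ring
  rw [h, coord_add_pi, coord_add_right, coord_sub_right, Real.cos_pi_div_six, Real.sin_pi_div_six]
  ring

/-- The cost of a chain starting at the centre is bounded below along the chain. -/
theorem FChain.le_cost {ω : ℝ → ℝ} (h : FChain (Good ω) 1 a e p C) (s : ℝ)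
    (hs : a + Real.pi / 3 ≤ s) (hs' : s = a + Real.pi / 3 ∨ s ≤ e) :
    Real.sqrt 3 + (ω s - ω (a + Real.pi / 3)) + coord p (s + Real.pi / 2) ≤ C := by
  have hpi := Real.pi_pos
  induction h generalizing s with
  | @single e p C h₁ h₂ h₃ h₄ =>
    -- The first leg is projected on the direction of the optimal deployment; coord p a ≥ 1 then
    -- yields √3.
    have h₅ := coord_le_norm p (a + Real.pi / 6)
    rw [cos_pi_div_six_mul] at h₅
    have h₆ : Real.sqrt 3 * 1 ≤ Real.sqrt 3 * coord p a := by gcongr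
    rcases hs' with rfl | hs'
    · linarith
    · linarith [h₃ _ _ (by linarith) hs hs']
  | @snoc e e' p q C C' h₁ h₂ h₃ h₄ ih =>
    by_cases hse : s = a + Real.pi / 3 ∨ s ≤ e
    · linarith [ih s hs hse, coord_sub_le_dist q p (s + Real.pi / 2), dist_comm p q]
    · push Not at hse
      -- The move to q is charged at the angle where q takes over, or at a + π/3 if the earlier
      -- tiles end before it; from there to s the goodness of q applies.
      have hse' : s ≤ e' := hs'.resolve_left hse.1
      have h₅ := ih (max (a + Real.pi / 3) e) (le_max_left _ _)
        ((le_total e (a + Real.pi / 3)).imp max_eq_left fun h => (max_eq_right h).le)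
      have h₆ := h₃ (max (a + Real.pi / 3) e) s (le_max_right _ _) (max_le hs hse.2.le) hse'
      linarith [coord_sub_le_dist q p (max (a + Real.pi / 3) e + Real.pi / 2), dist_comm p q]

/-- This is the calibration with weight ω = id, read at s = e - π/2, where the remaining term is
coord p e ≥ 1. -/
theorem FChain.le_cost_of_covers (h : FChain Covers 1 a e p C)
    (hae : a + 5 * Real.pi / 6 ≤ e) :
    1 + Real.sqrt 3 + (e - a) - 5 * Real.pi / 6 ≤ C := by
  have hpi := Real.pi_pos
  have h₁ := (h.mono_good (G' := Good id) fun s t z _ _ _ hz => hz.good (by simp)).le_cost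
    (e - Real.pi / 2) (by linarith) (Or.inr (by linarith))
  rw [sub_add_cancel] at h₁
  simp only [id] at h₁
  linarith [h.one_le_coord]

end Chains

/-- In time, the tour sweeps from x up to c, jumps to Z, which inspects x, and then sweeps down to
a. Switching the first sweep makes it run from c down to x, so the whole tour sweeps [a, c]
monotonically. The exceptions: z cannot inspect the complement of [x, c], as it misses ν; if Z does,
the first sweep and Z together cover a full turn, for which the bound is at least as large. -/
theorem lower_bound_of_forward_tail {a x c C₁ C₂ Λ ν : ℝ} {z Z : Plane}
    (h₁ : FChain Covers 1 x c z C₁) (h₂ : FChain Covers 0 a x Z C₂)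
    (hc : 5 * Real.pi / 6 ≤ c - a) (hc' : c - a ≤ 2 * Real.pi)
    (hΛ : C₁ + dist z Z + C₂ ≤ Λ) (hν : a ≤ ν) (hν' : ν ≤ x) (hzν : coord z ν < 1) :
    1 + Real.sqrt 3 + (c - a) - 5 * Real.pi / 6 ≤ Λ := by
  have hC₂ : 0 ≤ C₂ := by simpa using h₂.norm_le le_rfl zero_le_one
  have hax := h₂.le
  rcases h₁.switch zero_le_one le_rfl le_rfl (by linarith) (covers_singleton h₂.one_le_coord) with
    h₃ | h₃ | h₃
  · obtain ⟨p, hp, -⟩ := (h₃.refl 0).append (G := Covers) (h₂.refl 0) fun _ _ _ _ _ h => h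
    have := hp.le_cost_of_covers (by linarith)
    linarith
  · have := h₃ (ν + 2 * Real.pi) (by linarith) (by linarith)
    rw [coord_add_two_pi] at this
    linarith
  · have h₄ := (FChain.snoc h₁ (by linarith) h₃ le_rfl).le_cost_of_covers (by
      linarith [Real.pi_pos])
    linarith

/-- The tour sweeps from x up to c, leaps over the gap [c, a + 2π] and goes on up to x + 2π. It is
calibrated over this full turn with a weight that does not grow on the gap, so only the length c - a
counts. -/
theorem lower_bound_of_crossing_gap {a x c m C₁ C₂ : ℝ} {z Z : Plane}
    (h₁ : FChain Covers 1 x c z C₁) (h₂ : BChain 0 x a Z C₂)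
    (hc' : c - a ≤ 2 * Real.pi) (hm : m = (a + x) / 2) (hcm : m + Real.pi / 2 < c)
    (hz : coord z (m + Real.pi / 2) ≤ 0) (hZ : coord Z (m + Real.pi / 2) ≤ 0) :
    1 + Real.sqrt 3 + (c - a) - 5 * Real.pi / 6 ≤ C₁ + dist z Z + C₂ := by
  have hpi := Real.pi_pos
  have hax := h₂.le
  have hxc := h₁.le
  have hpi' : m + Real.pi / 2 + Real.pi = m + 3 * Real.pi / 2 := by ring
  replace hz : 0 ≤ coord z (m + 3 * Real.pi / 2) := by rw [← hpi', coord_add_pi]; linarith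
  replace hZ : 0 ≤ coord Z (m + 3 * Real.pi / 2) := by rw [← hpi', coord_add_pi]; linarith
  obtain ⟨κ, hκ⟩ : ∃ κ, κ = a + 2 * Real.pi := ⟨_, rfl⟩
  have hzc := h₁.one_le_coord
  have hZκ : 1 ≤ coord Z κ := by rw [hκ, coord_add_two_pi]; exact h₂.one_le_coord
  -- The handover angle ν is m + 3π/2, where both coordinates are nonnegative, clamped to the gap
  -- [c, κ].
  obtain ⟨ν, hcν, hνκ, hzν, hZν⟩ : ∃ ν, c ≤ ν ∧ ν ≤ κ ∧ (∀ φ, c ≤ φ → φ ≤ ν → 0 ≤ coord z φ) ∧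
      (∀ φ, ν ≤ φ → φ ≤ κ → 0 ≤ coord Z φ) := by
    have hz' : ∀ φ, c ≤ φ → φ ≤ m + 3 * Real.pi / 2 → 0 ≤ coord z φ := fun φ i₁ i₂ =>
      le_coord_of_mem_Icc le_rfl (by linarith) (by linarith) hz i₁ i₂
    have hZ' : ∀ φ, m + 3 * Real.pi / 2 ≤ φ → φ ≤ κ → 0 ≤ coord Z φ := fun φ i₁ i₂ =>
      le_coord_of_mem_Icc le_rfl (by linarith) hZ (by linarith) i₁ i₂
    rcases le_total (m + 3 * Real.pi / 2) c with i | i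
    · exact ⟨c, le_rfl, by linarith, fun φ i₁ i₂ => by rw [le_antisymm i₂ i₁]; linarith,
        fun φ i₁ i₂ => hZ' φ (i.trans i₁) i₂⟩
    rcases le_total (m + 3 * Real.pi / 2) κ with j | j
    · exact ⟨_, i, j, hz', hZ'⟩
    · exact ⟨κ, by linarith, le_rfl, fun φ i₁ i₂ => hz' φ i₁ (i₂.trans j),
        fun φ i₁ i₂ => by rw [le_antisymm i₂ i₁]; linarith⟩
  -- The weight has slope 1 outside the gap and is constant on it.
  obtain ⟨ω, hω⟩ : ∃ ω : ℝ → ℝ, ∀ s, ω s = min s c + max (s - κ) 0 := ⟨_, fun _ => rfl⟩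
  have hgap : ∀ s, c ≤ s → s ≤ κ → ω s = c := fun s i₁ i₂ => by
    rw [hω, min_eq_right i₁, max_eq_right (by linarith), add_zero]
  have hlow : ∀ s, s ≤ c → ω s = s := fun s i₁ => by
    rw [hω, min_eq_left i₁, max_eq_right (by linarith), add_zero]
  have hhigh : ∀ s, κ ≤ s → ω s = c + (s - κ) := fun s i₁ => by
    rw [hω, min_eq_right (by linarith), max_eq_left (by linarith)]
  have hlip : ∀ s t, s ≤ t → ω t - ω s ≤ t - s := by
    intro s t hst
    rcases le_total t c with i | i
    · rw [hlow t i, hlow s (hst.trans i)]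
    rcases le_total t κ with j | j <;> rcases le_total s c with k | k <;>
      rcases le_total s κ with l | l <;>
      simp only [hlow, hgap, hhigh, i, j, k, l] <;> linarith
  have hgood : ∀ s t z, Covers s t z → Good ω s t z := fun s t z h =>
    h.good fun _ _ _ h _ => hlip _ _ h
  have hgood' : ∀ s t z, c ≤ s → t ≤ κ → (∀ φ, s ≤ φ → φ ≤ t → 0 ≤ coord z φ) → Good ω s t z := by
    intro s t z i₁ i₂ h u v i₃ i₄ i₅
    rw [hgap u (by linarith) (by linarith), hgap v (by linarith) (by linarith)]
    have := coord_add_pi_div_two_add_le (r := 0) i₄ fun φ j₁ j₂ =>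
      h φ (by linarith) (by linarith)
    linarith
  -- On the gap z serves up to ν and Z afterwards. They need not inspect it: a nonnegative
  -- coordinate is enough where the weight is constant.
  have h₃ : FChain (Good ω) 1 x κ Z (C₁ + dist z Z) := by
    refine .snoc (.snoc (h₁.mono_good fun s t z _ _ _ h => hgood s t z h) hcν
      (hgood' _ _ _ le_rfl hνκ hzν) (q := z) (C' := C₁) (by simp)) hνκ
      (hgood' _ _ _ hcν le_rfl hZν) le_rfl
  obtain ⟨p, hp, hp'⟩ := (hκ ▸ h₃).append (h₂.add_two_pi) fun s t z _ _ h => hgood s t z h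
  have h₄ := hp.le_cost (x + 2 * Real.pi - Real.pi / 2) (by linarith) (Or.inr (by linarith))
  rw [sub_add_cancel] at h₄
  -- The comparison point is one full turn later, beyond κ, where ω is explicit. It gives ω s ≥ s -
  -- (κ - c) without deciding whether s lies in the gap.
  have h₅ := hlip (x + 2 * Real.pi - Real.pi / 2) (κ + (x + 2 * Real.pi - Real.pi / 2 - a))
    (by linarith)
  rw [hhigh (κ + (x + 2 * Real.pi - Real.pi / 2 - a)) (by linarith)] at h₅
  have h₆ : ω (x + Real.pi / 3) ≤ x + Real.pi / 3 := by
    have := hlip a (x + Real.pi / 3) (by linarith)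
    rw [hlow a (by linarith)] at this
    linarith
  linarith

/-- After reaching c the tour jumps to Z, which inspects a, and sweeps up to x. With respect to the
bisector of [a, x]: if Z is on the side of x, it inspects all of [a, x] alone; if Z and z are on
opposite sides, reflecting the tail gives a forward tail no farther from z; if both are on the side
of a, the tour crosses the gap. The missed directions ν and ν' exclude the complementary
alternatives. -/
theorem lower_bound_of_backward_tail {a x c C₁ C₂ ν ν' : ℝ} {z Z : Plane}
    (h₁ : FChain Covers 1 x c z C₁) (h₂ : BChain 0 x a Z C₂)
    (hc : 5 * Real.pi / 6 ≤ c - a) (hc' : c - a ≤ 2 * Real.pi)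
    (hν₁ : a ≤ ν) (hν₂ : ν ≤ x) (hzν : coord z ν < 1)
    (hν₁' : x ≤ ν') (hν₂' : ν' ≤ c) (hZν : coord Z ν' < 1) :
    1 + Real.sqrt 3 + (c - a) - 5 * Real.pi / 6 ≤ C₁ + dist z Z + C₂ := by
  have hpi := Real.pi_pos
  have hax := h₂.le
  have hxc := h₁.le
  obtain ⟨m, hm⟩ : ∃ m, m = (a + x) / 2 := ⟨_, rfl⟩
  rcases le_total 0 (coord Z (m + Real.pi / 2)) with hZ | hZ
  · rcases covers_of_axis' (m := m) (δ := (x - a) / 2) (by linarith) (by linarith)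
      (by convert h₂.one_le_coord using 2; linarith) hZ with ⟨-, h₃⟩ | ⟨-, h₃⟩
    · exact lower_bound_of_forward_tail h₁ (.single_covers hax
        (h₃.mono (by linarith) (by linarith)) (h₂.norm_le le_rfl zero_le_one)) hc hc' le_rfl
        hν₁ hν₂ hzν
    · linarith [h₃ ν' (by linarith) (by linarith)]
  rcases le_total 0 (coord z (m + Real.pi / 2)) with hz | hz
  · have h₃ : FChain Covers 0 a x (refl m Z) C₂ := by convert h₂.refl m using 1 <;> linarith
    refine lower_bound_of_forward_tail h₁ h₃ hc hc' ?_ hν₁ hν₂ hzν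
    have := dist_refl_le (m := m) (z := Z) (w := z) (mul_nonpos_of_nonpos_of_nonneg hZ hz)
    rw [dist_comm z, dist_comm z]
    linarith
  refine lower_bound_of_crossing_gap h₁ h₂ hc' hm ?_ hz hZ
  -- If c were within π/2 of the axis, z, which is on the other side, would inspect everything
  -- between c and its mirror image, including ν.
  by_contra! hcm
  rcases covers_of_axis (m := m) (δ := c - m) (by linarith) (by linarith)
    (by rw [add_sub_cancel]; exact h₁.one_le_coord) hz with ⟨-, h₃⟩ | ⟨h₃, -⟩
  · linarith [h₃ ν (by linarith) (by linarith)]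
  · linarith

/-! ### Polygonal lines -/

/-- The length of the polygonal line through a list of points. -/
noncomputable def pathLength : List Plane → ℝ
  | [] => 0
  | [_] => 0
  | p :: q :: l => dist p q + pathLength (q :: l)

@[simp] theorem pathLength_singleton (p : Plane) : pathLength [p] = 0 := rfl
@[simp] theorem pathLength_cons_cons (p q : Plane) (l : List Plane) :
    pathLength (p :: q :: l) = dist p q + pathLength (q :: l) := rfl

theorem pathLength_append (p : Plane) (B : List Plane) :
    ∀ A, pathLength (A ++ p :: B) = pathLength (A ++ [p]) + pathLength (p :: B)
  | [] => by simp
  | [a] => by simp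
  | a :: a' :: A => by
    have := pathLength_append p B (a' :: A)
    simp only [List.cons_append, pathLength_cons_cons] at this ⊢
    rw [this, add_assoc]

theorem pathLength_reverse : ∀ l, pathLength l.reverse = pathLength l
  | [] => rfl
  | [_] => rfl
  | p :: q :: l => by
    have := pathLength_reverse (q :: l)
    rw [List.reverse_cons] at this
    rw [List.reverse_cons, List.reverse_cons, List.append_assoc, List.singleton_append,
      pathLength_append, this, pathLength_cons_cons, pathLength_cons_cons, pathLength_singleton,
      dist_comm]
    ring

/-- `w` times the norm of the last point plus the length of the polygonal line. -/
noncomputable def chainCost (y : ℕ → Plane) (w : ℝ) : List ℕ → ℝ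
  | [] => 0
  | [q] => w * ‖y q‖
  | q :: p :: l => chainCost y w (p :: l) + dist (y p) (y q)

theorem chainCost_zero (y : ℕ → Plane) : ∀ l, chainCost y 0 l = pathLength (l.map y)
  | [] => rfl
  | [_] => by simp [chainCost]
  | q :: p :: l => by
    have := chainCost_zero y (p :: l)
    simp only [List.map_cons, pathLength_cons_cons, chainCost] at this ⊢
    rw [this, dist_comm]; ring

theorem chainCost_one (y : ℕ → Plane) :
    ∀ l, l ≠ [] → chainCost y 1 l = pathLength (l.map y ++ [0])
  | [], h => absurd rfl h
  | [_], _ => by simp [chainCost]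
  | q :: p :: l, _ => by
    have := chainCost_one y (p :: l) (by simp)
    simp only [List.map_cons, List.cons_append, pathLength_cons_cons, chainCost] at this ⊢
    rw [this, dist_comm]; ring

/-- If the set of points visited is at every moment a set of consecutive tiles, the points form
a chain, up to reflections that do not increase the length. -/
theorem chain_of_growing {y : ℕ → Plane} {b : ℕ → ℝ} {w : ℝ} (hw : 0 ≤ w) (hw₁ : w ≤ 1)
    (hb : Monotone b) (ν : ℝ) : ∀ (l : List ℕ) (q : ℕ), (q :: l).Nodup →
      (∀ t, t <:+ q :: l → ∀ i j k, i < j → j < k → i ∈ t → k ∈ t → j ∈ t) →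
      (∀ i ∈ q :: l, Covers (b i) (b (i + 1)) (y i) ∧ b (i + 1) ≤ ν ∧ ν ≤ b i + 2 * Real.pi ∧
        coord (y i) ν < 1) →
      ∃ lo hi, (∀ i, i ∈ q :: l ↔ lo ≤ i ∧ i < hi) ∧ (q = lo ∨ q + 1 = hi) ∧
        (q + 1 = hi → FChain Covers w (b lo) (b hi) (y q) (chainCost y w (q :: l))) ∧
        (q = lo → BChain w (b hi) (b lo) (y q) (chainCost y w (q :: l)))
  | [], q, _, _, hq => by
    have h := hq q (by simp)
    refine ⟨q, q + 1, fun i => ?_, Or.inl rfl, fun _ => ?_, fun _ => ?_⟩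
    · simp only [List.mem_singleton]; omega
    · exact .single_covers (hb (by omega)) h.1 le_rfl
    · exact .single (hb (by omega)) h.1 le_rfl
  | p :: l, q, hnd, hconv, hq => by
    obtain ⟨lo, hi, hmem, hp, hF, hB⟩ := chain_of_growing hw hw₁ hb ν l p
      (List.nodup_cons.1 hnd).2 (fun t ht => hconv t (ht.trans (List.suffix_cons _ _)))
      (fun i hi => hq i (List.mem_cons_of_mem _ hi))
    have hqmem : ¬(lo ≤ q ∧ q < hi) := fun h => (List.nodup_cons.1 hnd).1 ((hmem q).2 h)
    have hpmem := (hmem p).1 (by simp)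
    have hmem' : ∀ i, i ∈ q :: p :: l ↔ i = q ∨ (lo ≤ i ∧ i < hi) := fun i => by
      rw [List.mem_cons, hmem]
    have hcv := hconv _ (List.suffix_refl _)
    simp only [hmem'] at hcv
    have hlo := hq lo (by rw [hmem']; omega)
    have hhi := hq (hi - 1) (by rw [hmem']; omega)
    rw [Nat.sub_add_cancel (by omega)] at hhi
    have hp' := hq p (by simp)
    have hq' := hq q (by simp)
    rcases lt_or_ge q lo with hlt | hge
    · have hqlo : q + 1 = lo := by
        by_contra hne
        have := hcv q (q + 1) lo (by omega) (by omega) (by omega) (by omega)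
        omega
      refine ⟨q, hi, fun i => by rw [hmem']; omega, Or.inl rfl, fun h => by omega, fun _ => ?_⟩
      subst hqlo
      rcases hp with hp | hp
      · exact .snoc (hB hp) (hb (by omega)) hq'.1 le_rfl
      -- The tour changes ends here, so the chain must be switched. The exceptional cases would make
      -- p or q inspect ν.
      · rcases (hF hp).switch hw hw₁ (hb (Nat.le_succ q)) (hhi.2.1.trans hlo.2.2.1) hq'.1 with
          h | h | h
        · exact h
        · linarith [h ν hhi.2.1 hlo.2.2.1]
        · linarith [h ν hhi.2.1 hlo.2.2.1]
    · have hqhi : q = hi := by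
        by_contra hne
        have := hcv lo hi q (by omega) (by omega) (by omega) (by omega)
        omega
      refine ⟨lo, q + 1, fun i => by rw [hmem']; omega, Or.inr rfl, fun _ => ?_, fun h => by omega⟩
      subst hqhi
      rcases hp with hp | hp
      · rcases (hB hp).switch hw hw₁ (hb (Nat.le_succ q)) (hhi.2.1.trans hlo.2.2.1) hq'.1 with
          h | h | h
        · exact h
        · linarith [h ν hhi.2.1 hlo.2.2.1]
        · linarith [h ν hhi.2.1 hlo.2.2.1]
      · exact .snoc (hF hp) (hb (by omega)) hq'.1 le_rfl

/-- No prefix of the list `L` separates four ranks alternately. -/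
def NonInterlacing (L : List ℕ) : Prop := ∀ P Q, L = P ++ Q → ∀ i j k l, i < j → j < k → k < l →
  ¬(i ∈ P ∧ j ∈ Q ∧ k ∈ P ∧ l ∈ Q) ∧ ¬(i ∈ Q ∧ j ∈ P ∧ k ∈ Q ∧ l ∈ P)

/-- Points tiling an arc, each of which inspects a direction which none of the others inspects. -/
structure Tiling (M : ℕ) (y : ℕ → Plane) (b n : ℕ → ℝ) : Prop where
  mono : Monotone b
  covers : ∀ i ≤ M, Covers (b i) (b (i + 1)) (y i)
  le_private : ∀ i ≤ M, b i ≤ n i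
  private_le : ∀ i ≤ M, n i ≤ b (i + 1)
  coord_private : ∀ i ≤ M, ∀ j ≤ M, i ≠ j → coord (y i) (n j) < 1
  le_length : 5 * Real.pi / 6 ≤ b (M + 1) - b 0
  length_le : b (M + 1) - b 0 ≤ 2 * Real.pi

/-- Since M is visited before 0, non-interlacing forces every rank visited up to M to exceed every
later one. The tour thus splits into a first phase on [lo, M], growing through intervals from the
centre and ending at M, and a second phase on [0, lo), which grows through intervals when read
backwards in time. Each phase becomes a chain; its end Z determines which tail lemma applies. -/
theorem Tiling.lower_bound_of_last_before_first {M : ℕ} {y : ℕ → Plane} {b n : ℕ → ℝ}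
    (T : Tiling M y b n) {A B : List ℕ} (hL : (A ++ M :: B).Perm (List.range (M + 1)))
    (hNI : NonInterlacing (A ++ M :: B)) (h0 : 0 ∈ B) :
    1 + Real.sqrt 3 + (b (M + 1) - b 0) - 5 * Real.pi / 6 ≤
      pathLength (0 :: (A ++ M :: B).map y) := by
  have hpi := Real.pi_pos
  have hmem : ∀ i, i ∈ A ++ M :: B ↔ i < M + 1 := fun i => by rw [hL.mem_iff, List.mem_range]
  have hnd : (A ++ M :: B).Nodup := hL.nodup_iff.2 List.nodup_range
  have hsub : ∀ {i}, i ∈ A ++ M :: B → i ≤ M := fun h => Nat.lt_succ_iff.1 ((hmem _).1 h)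
  -- the points after the last rank have smaller rank than those before
  have hdisj : ∀ {P Q : List ℕ}, A ++ M :: B = P ++ Q → ∀ {i j}, i ∈ P → j ∈ Q → i ≠ j := by
    rintro P Q h i j hi hj rfl
    rw [h] at hnd
    exact (List.nodup_append.1 hnd).2.2 _ hi _ hj rfl
  have hHd : A ++ M :: B = (A ++ [M]) ++ B := by simp
  have hlt : ∀ i ∈ A ++ [M], ∀ j ∈ B, j < i := by
    intro i hi j hj
    by_contra! hij
    have h₁ : i ≠ j := hdisj hHd hi hj
    have h₂ : i ≠ 0 := hdisj hHd hi h0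
    have h₃ : M ≠ j := hdisj hHd (by simp) hj
    have h₄ : j ≤ M := hsub (by simp [hj])
    exact (hNI _ _ hHd 0 i j M (by omega) (by omega) (by omega)).2 ⟨h0, hi, hj, by simp⟩
  obtain ⟨Z, B', rfl⟩ : ∃ Z B', B = Z :: B' := by
    cases B with
    | nil => simp at h0
    | cons Z B' => exact ⟨Z, B', rfl⟩
  have hZM : Z < M := hlt M (by simp) Z (by simp)
  have hbM : ∀ i ≤ M, b (i + 1) ≤ b (M + 1) := fun i hi => T.mono (by omega)
  have hb0 : ∀ i, b 0 ≤ b i := fun i => T.mono (by omega)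
  have hnZ := T.le_private Z hZM.le
  have hnZ' := T.private_le Z hZM.le
  have hnM := T.le_private M le_rfl
  have hnM' := T.private_le M le_rfl
  have hlen := T.length_le
  -- The private direction of Z, shifted by a full turn, is missed by the whole first phase; that of
  -- M will play this role for the second phase.
  obtain ⟨lo, hi, hm₁, -, hF, -⟩ := chain_of_growing (w := 1) (y := y) zero_le_one le_rfl T.mono
    (n Z + 2 * Real.pi) A.reverse M
    (by
      have := (List.nodup_append.1 (hHd ▸ hnd)).1
      rw [← List.nodup_reverse] at this
      simpa using this)
    (by
      intro t ht i j k hij hjk hi hk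
      by_contra hj
      obtain ⟨P, hP⟩ := ht
      have h₁ : A ++ M :: Z :: B' = t.reverse ++ (P.reverse ++ Z :: B') := by
        have := congrArg List.reverse hP
        simp only [List.reverse_append, List.reverse_cons, List.reverse_reverse] at this
        rw [← List.append_assoc, this]
        simp
      have hk' : k ≤ M := hsub (h₁ ▸ by simp [hk])
      have hj' : j ∈ t.reverse ++ (P.reverse ++ Z :: B') := h₁ ▸ (hmem j).2 (by omega)
      rw [List.mem_append, List.mem_reverse] at hj'
      have h0' : 0 ∈ P.reverse ++ Z :: B' := List.mem_append_right _ h0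
      have hi0 : i ≠ 0 := hdisj h₁ (by simpa using hi) h0'
      exact (hNI _ _ h₁ 0 i j k (by omega) hij hjk).2
        ⟨h0', by simpa using hi, hj'.resolve_left hj, by simpa using hk⟩)
    (by
      intro i hi
      have hi' : i ∈ A ++ [M] := by simpa [or_comm] using hi
      have hiM : i ≤ M := hsub (by rw [hHd]; exact List.mem_append_left _ hi')
      have hZi := hlt i hi' Z (by simp)
      refine ⟨T.covers i hiM, ?_, ?_, ?_⟩
      · linarith [hbM i hiM, hb0 Z]
      · have : b (Z + 1) ≤ b i := T.mono (by omega)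
        linarith
      · rw [coord_add_two_pi]
        exact T.coord_private i hiM Z hZM.le (by omega))
  obtain ⟨lo', hi', hm₂, hZ, hF', hB'⟩ := chain_of_growing (w := 0) (y := y) le_rfl zero_le_one
    T.mono (n M) B' Z
    ((List.nodup_cons.1 (List.nodup_append.1 hnd).2.1).2)
    (by
      intro t ht i j k hij hjk hi hk
      by_contra hj
      obtain ⟨P, hP⟩ := ht
      have h₁ : A ++ M :: Z :: B' = (A ++ M :: P) ++ t := by rw [← hP]; simp
      have hkM : k < M := hlt M (by simp) k (by rw [← hP]; simp [hk])
      have hj' : j ∈ (A ++ M :: P) ++ t := h₁ ▸ (hmem j).2 (by omega)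
      rw [List.mem_append] at hj'
      exact (hNI _ _ h₁ i j k M hij hjk hkM).2 ⟨hi, hj'.resolve_right hj, hk, by simp⟩)
    (by
      intro i hi
      have hiM : i < M := hlt M (by simp) i hi
      refine ⟨T.covers i hiM.le, ?_, ?_, T.coord_private i hiM.le M le_rfl hiM.ne⟩
      · have : b (i + 1) ≤ b M := T.mono (by omega)
        linarith
      · linarith [hb0 i])
  have e₁ : hi = M + 1 := by
    have h₁ := (hm₁ M).1 (by simp)
    have h₂ := (hm₁ (hi - 1)).2 (by omega)
    have h₃ : hi - 1 ≤ M := hsub (by rw [hHd]; apply List.mem_append_left; simpa [or_comm] using h₂)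
    omega
  have e₂ : lo' = 0 := by
    have := (hm₂ 0).1 h0
    omega
  have e₃ : hi' = lo := by
    have h₁ := (hm₂ Z).1 (by simp)
    have h₂ := (hm₁ M).1 (by simp)
    have h₃ := (hm₂ (hi' - 1)).2 (by omega)
    have h₄ := (hm₁ lo).2 (by omega)
    have h₅ := hlt lo (by simpa [or_comm] using h₄) _ h₃
    by_contra hne
    have h₆ := (hmem hi').2 (by omega)
    rw [hHd, List.mem_append] at h₆
    rcases h₆ with h₆ | h₆
    · have := (hm₁ hi').1 (by simpa [or_comm] using h₆)
      omega
    · have := (hm₂ hi').1 h₆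
      omega
  subst e₁ e₂ e₃
  have hcost : pathLength (0 :: (A ++ M :: Z :: B').map y) =
      chainCost y 1 (M :: A.reverse) + dist (y M) (y Z) + chainCost y 0 (Z :: B') := by
    rw [chainCost_zero, chainCost_one _ _ (by simp), ← pathLength_reverse (_ ++ [0])]
    have : 0 :: (A ++ M :: Z :: B').map y = (0 :: A.map y) ++ y M :: (Z :: B').map y := by simp
    rw [this, pathLength_append]
    simp [add_assoc]
  rw [hcost]
  have hZhi := (hm₂ Z).1 (by simp)
  have hloM := (hm₁ M).1 (by simp)
  have hu₁ : n Z ≤ b hi' := hnZ'.trans (T.mono (by omega))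
  have hu₂ : b hi' ≤ n M := (T.mono (by omega : hi' ≤ M)).trans hnM
  have hzν := T.coord_private M le_rfl Z hZM.le hZM.ne'
  rcases hZ with hZ | hZ
  · exact lower_bound_of_backward_tail (hF rfl) (hB' hZ) T.le_length T.length_le
      ((hb0 Z).trans hnZ) hu₁ hzν hu₂ hnM' (T.coord_private Z hZM.le M le_rfl hZM.ne)
  · exact lower_bound_of_forward_tail (hF rfl) (hF' hZ) T.le_length T.length_le le_rfl
      ((hb0 Z).trans hnZ) hu₁ hzν

/-- Mirror symmetry exchanges the ranks 0 and M, so that M may be assumed to be visited before 0. -/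
theorem Tiling.reverse {M : ℕ} {y : ℕ → Plane} {b n : ℕ → ℝ} (T : Tiling M y b n) :
    Tiling M (fun i => refl 0 (y (M - i))) (fun i => -b (M + 1 - i)) (fun i => -n (M - i)) where
  mono i j hij := neg_le_neg (T.mono (by omega))
  covers i hi := by
    have h := (T.covers (M - i) (by omega)).refl (m := 0)
    rw [show M - i + 1 = M + 1 - i by omega] at h
    rw [show M + 1 - (i + 1) = M - i by omega]
    simpa using h
  le_private i hi := by
    have h := T.private_le (M - i) (by omega)
    rw [show M - i + 1 = M + 1 - i by omega] at h
    exact neg_le_neg h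
  private_le i hi := by
    rw [show M + 1 - (i + 1) = M - i by omega]
    exact neg_le_neg (T.le_private (M - i) (by omega))
  coord_private i hi j hj hij := by
    rw [coord_refl]
    simpa using T.coord_private (M - i) (by omega) (M - j) (by omega) (by omega)
  le_length := by simpa [add_comm, sub_eq_add_neg] using T.le_length
  length_le := by simpa [add_comm, sub_eq_add_neg] using T.length_le

theorem NonInterlacing.reverse {L : List ℕ} (h : NonInterlacing L) (M : ℕ) :
    NonInterlacing (L.map (M - ·)) := by
  intro P' Q' hPQ i j k l hij hjk hkl
  obtain ⟨P, Q, hL, rfl, rfl⟩ := List.map_eq_append_iff.1 hPQ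
  simp only [List.mem_map]
  constructor
  · rintro ⟨⟨i, hi, rfl⟩, ⟨j, hj, rfl⟩, ⟨k, hk, rfl⟩, ⟨l, hl, rfl⟩⟩
    exact (h P Q hL l k j i (by omega) (by omega) (by omega)).2 ⟨hl, hk, hj, hi⟩
  · rintro ⟨⟨i, hi, rfl⟩, ⟨j, hj, rfl⟩, ⟨k, hk, rfl⟩, ⟨l, hl, rfl⟩⟩
    exact (h P Q hL l k j i (by omega) (by omega) (by omega)).1 ⟨hl, hk, hj, hi⟩

theorem pathLength_map_refl (m : ℝ) : ∀ l, pathLength (l.map (refl m)) = pathLength l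
  | [] => rfl
  | [_] => rfl
  | p :: q :: l => by
    have := pathLength_map_refl m (q :: l)
    simp only [List.map_cons, pathLength_cons_cons, dist_refl_refl] at this ⊢
    rw [this]

theorem map_sub_perm_range {M : ℕ} {L : List ℕ} (hL : L.Perm (List.range (M + 1))) :
    (L.map (M - ·)).Perm (List.range (M + 1)) := by
  refine (hL.map _).trans ((List.perm_ext_iff_of_nodup ?_ List.nodup_range).2 fun i => ?_)
  · refine List.Nodup.map_on (fun i hi j hj h => ?_) List.nodup_range
    rw [List.mem_range] at hi hj
    omega
  · simp only [List.mem_map, List.mem_range]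
    exact ⟨fun ⟨j, hj, h⟩ => by omega, fun h => ⟨M - i, by omega, by omega⟩⟩

theorem Tiling.lower_bound {M : ℕ} {y : ℕ → Plane} {b n : ℕ → ℝ}
    (T : Tiling M y b n) {L : List ℕ} (hL : L.Perm (List.range (M + 1)))
    (hNI : NonInterlacing L) :
    1 + Real.sqrt 3 + (b (M + 1) - b 0) - 5 * Real.pi / 6 ≤ pathLength (0 :: L.map y) := by
  have h0 : 0 ∈ L := hL.mem_iff.2 (by simp)
  have hM : M ∈ L := hL.mem_iff.2 (by simp)
  obtain ⟨A, B, rfl⟩ := List.append_of_mem hM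
  rcases Nat.eq_zero_or_pos M with rfl | hM
  · have hcv := T.covers 0 le_rfl
    have h₁ := (FChain.single_covers (w := 1) (T.mono (Nat.zero_le 1)) hcv le_rfl).le_cost_of_covers
      (by linarith [T.le_length])
    have h₂ : A ++ 0 :: B = [0] := by
      have : (A ++ 0 :: B).length = 1 := hL.length_eq
      have hA : A = [] := List.length_eq_zero_iff.1 (by simp at this; omega)
      have hB : B = [] := List.length_eq_zero_iff.1 (by simp at this; omega)
      simp [hA, hB]
    rw [h₂]
    simpa using h₁
  have h0' : 0 ∈ A ∨ 0 ∈ B := by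
    simp only [List.mem_append, List.mem_cons] at h0
    rcases h0 with h | h | h
    · exact Or.inl h
    · omega
    · exact Or.inr h
  rcases h0' with h0' | h0'
  · obtain ⟨A', B', rfl⟩ := List.append_of_mem h0'
    have h₁ := map_sub_perm_range hL
    have h₂ := hNI.reverse M
    have e : ((A' ++ 0 :: B') ++ M :: B).map (M - ·) =
      A'.map (M - ·) ++ M :: (B' ++ M :: B).map (M - ·) := by simp
    rw [e] at h₁ h₂
    have h₃ := T.reverse.lower_bound_of_last_before_first h₁ h₂ (by simp)
    rw [← e] at h₃
    have h₄ : 0 :: List.map (fun i => refl 0 (y (M - i))) (((A' ++ 0 :: B') ++ M :: B).map (M - ·)) =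
        (0 :: ((A' ++ 0 :: B') ++ M :: B).map y).map (refl 0) := by
      rw [List.map_cons, refl_zero, List.map_map, List.map_map]
      congr 1
      refine List.map_congr_left fun i hi => ?_
      have : i < M + 1 := List.mem_range.1 (hL.mem_iff.1 hi)
      simp only [Function.comp]
      rw [show M - (M - i) = i by omega]
    rw [h₄, pathLength_map_refl] at h₃
    simp only [Nat.sub_self, Nat.sub_zero] at h₃
    linarith
  · exact T.lower_bound_of_last_before_first hL hNI h0'

/-! ### Crossing edges -/

/-- The direction `φ` is inspected from some point of `R` but from no point of `P`. -/
def Beats (R P : Set Plane) (φ : ℝ) : Prop := (∃ r ∈ R, 1 ≤ coord r φ) ∧ ∀ p ∈ P, coord p φ < 1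

theorem Beats.sub_two_pi {R P : Set Plane} {φ : ℝ} (h : Beats R P φ) :
    Beats R P (φ - 2 * Real.pi) := by
  simpa only [Beats, coord_sub_two_pi] using h

section Separated

variable {P R : Set Plane} {θ : ℝ} (hsep : ∀ p ∈ P, ∀ r ∈ R, coord p θ < coord r θ)
include hsep

/-- Let p inspect φ₂. Some r exceeds p both at θ and at whichever of φ₁, φ₃ lies beyond φ₂ from θ.
Hence r is at least p at φ₂, and so inspects it too. -/
theorem not_beats_beats_beats {φ₁ φ₂ φ₃ : ℝ} (h₁ : Beats R P φ₁) (h₂ : Beats P R φ₂)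
    (h₃ : Beats R P φ₃) (h : θ - Real.pi ≤ φ₁) (h₁₂ : φ₁ ≤ φ₂) (h₂₃ : φ₂ ≤ φ₃)
    (h' : φ₃ ≤ θ + Real.pi) : False := by
  obtain ⟨⟨p, hp, hp₂⟩, hR⟩ := h₂
  have key : ∀ r ∈ R, coord p θ < coord r θ := hsep p hp
  rcases le_total θ φ₂ with hle | hle
  · obtain ⟨⟨r, hr, hr₃⟩, hP⟩ := h₃
    have k₁ := key r hr
    have k₂ := hP p hp
    have k₃ := hR r hr
    rcases h'.lt_or_eq with hlt | rfl
    · have := le_coord_of_mem_Icc (z := r - p) (h := 0) (a := θ) (b := φ₃) (φ := φ₂) le_rfl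
        (by linarith) (by rw [coord_sub_left]; linarith) (by rw [coord_sub_left]; linarith) hle h₂₃
      rw [coord_sub_left] at this
      linarith
    · rw [coord_add_pi] at k₂ hr₃
      linarith
  · obtain ⟨⟨r, hr, hr₁⟩, hP⟩ := h₁
    have k₁ := key r hr
    have k₂ := hP p hp
    have k₃ := hR r hr
    rcases h.lt_or_eq with hlt | rfl
    · have := le_coord_of_mem_Icc (z := r - p) (h := 0) (a := φ₁) (b := θ) (φ := φ₂) le_rfl
        (by linarith) (by rw [coord_sub_left]; linarith) (by rw [coord_sub_left]; linarith) h₁₂ hle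
      rw [coord_sub_left] at this
      linarith
    · have e₁ := coord_add_pi p (θ - Real.pi)
      have e₂ := coord_add_pi r (θ - Real.pi)
      rw [sub_add_cancel] at e₁ e₂
      linarith

/-- Cut the circle opposite to θ: of four alternating directions, three in the forbidden pattern R,
P, R occur in order in the resulting window. -/
theorem not_interlaced_of_separated {φ₁ φ₂ φ₃ φ₄ : ℝ} (h₁ : Beats P R φ₁)
    (h₂ : Beats R P φ₂) (h₃ : Beats P R φ₃) (h₄ : Beats R P φ₄) (h₁₂ : φ₁ ≤ φ₂) (h₂₃ : φ₂ ≤ φ₃)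
    (h₃₄ : φ₃ ≤ φ₄) (h₄₁ : φ₄ ≤ φ₁ + 2 * Real.pi) (hθ : θ - Real.pi ≤ φ₁) (hθ' : φ₁ ≤ θ + Real.pi) :
    False := by
  rcases le_total φ₄ (θ + Real.pi) with h | h
  · exact not_beats_beats_beats hsep h₂ h₃ h₄ (by linarith) h₂₃ h₃₄ h
  rcases le_total φ₂ (θ + Real.pi) with h' | h'
  · exact not_beats_beats_beats hsep h₄.sub_two_pi h₁ h₂ (by linarith) (by linarith) h₁₂ h'
  · exact not_beats_beats_beats hsep h₂.sub_two_pi h₃.sub_two_pi h₄.sub_two_pi (by linarith)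
      (by linarith) (by linarith) (by linarith)

end Separated

theorem coord_add_int_mul (z : Plane) (θ : ℝ) (k : ℤ) :
    coord z (θ + k * (2 * Real.pi)) = coord z θ := by
  simp [coord, Real.cos_add_int_mul_two_pi, Real.sin_add_int_mul_two_pi]

/-- Disjoint compact convex sets are separated by the coordinate along some direction. -/
theorem exists_coord_lt_coord {s t : Set Plane} (hs : Convex ℝ s) (hs' : IsCompact s)
    (ht : Convex ℝ t) (ht' : IsClosed t) (hst : Disjoint s t) (φ : ℝ) :
    ∃ θ, θ - Real.pi ≤ φ ∧ φ ≤ θ + Real.pi ∧ ∀ p ∈ s, ∀ r ∈ t, coord p θ < coord r θ := by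
  obtain ⟨f, u, v, hu, huv, hv⟩ := geometric_hahn_banach_compact_closed hs hs' ht ht' hst
  obtain ⟨x, rfl⟩ := (InnerProductSpace.toDual ℝ Plane).surjective f
  obtain ⟨θ₀, hθ₀⟩ : ∃ θ₀, ∀ z : Plane, inner ℝ x z = ‖(⟨x 0, x 1⟩ : ℂ)‖ * coord z θ₀ := by
    refine ⟨Complex.arg ⟨x 0, x 1⟩, fun z => ?_⟩
    have h₁ := Complex.norm_mul_cos_arg ⟨x 0, x 1⟩
    have h₂ := Complex.norm_mul_sin_arg ⟨x 0, x 1⟩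
    simp only at h₁ h₂
    rw [PiLp.inner_apply, Fin.sum_univ_two, coord]
    simp only [RCLike.inner_apply, conj_trivial]
    linear_combination (-z 0) * h₁ - z 1 * h₂
  obtain ⟨k, hk, -⟩ := existsUnique_add_zsmul_mem_Ioc Real.two_pi_pos θ₀ (φ - Real.pi)
  rw [zsmul_eq_mul] at hk
  refine ⟨θ₀ + k * (2 * Real.pi), by linarith [hk.2], by linarith [hk.1], fun p hp r hr => ?_⟩
  rw [coord_add_int_mul, coord_add_int_mul]
  have h₁ := hu p hp
  have h₂ := hv r hr
  simp only [InnerProductSpace.toDual_apply_apply, hθ₀] at h₁ h₂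
  exact lt_of_mul_lt_mul_left (h₁.trans (huv.trans h₂)) (norm_nonneg _)

theorem coord_lt_of_mem_segment {p q z : Plane} {φ h : ℝ} (hp : coord p φ < h) (hq : coord q φ < h)
    (hz : z ∈ segment ℝ p q) : coord z φ < h := by
  obtain ⟨s, t, hs, ht, hst, rfl⟩ := hz
  rw [coord_add_left, coord_smul, coord_smul]
  rcases hs.eq_or_lt with rfl | hs
  · rw [show t = 1 by linarith]; linarith
  · have h₁ := mul_lt_mul_of_pos_left hp hs
    have h₂ := mul_le_mul_of_nonneg_left hq.le ht
    have h₃ : s * h + t * h = h := by rw [← add_mul, hst, one_mul]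
    linarith

/-- Points with private directions, listed in the order of these directions. -/
structure Privates (M : ℕ) (y : ℕ → Plane) (n : ℕ → ℝ) : Prop where
  lt : ∀ i j, i < j → j ≤ M → n i < n j
  le_two_pi : n M ≤ n 0 + 2 * Real.pi
  sees : ∀ i ≤ M, 1 ≤ coord (y i) (n i)
  not_sees : ∀ i ≤ M, ∀ j ≤ M, i ≠ j → coord (y i) (n j) < 1

section Crossing

variable {M : ℕ} {y : ℕ → Plane} {n : ℕ → ℝ}

theorem Privates.beats (H : Privates M y n) {i j k l : ℕ} (hi : i ≤ M) (hk : k ≤ M)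
    (hl : l ≤ M) (hik : i ≠ k) (hil : i ≠ l) :
    Beats (segment ℝ (y i) (y j)) (segment ℝ (y k) (y l)) (n i) :=
  ⟨⟨y i, left_mem_segment ℝ _ _, H.sees i hi⟩, fun _ hp => coord_lt_of_mem_segment
    (H.not_sees k hk i hi hik.symm) (H.not_sees l hl i hi hil.symm) hp⟩

/-- Edges with interlacing private directions cross. -/
theorem Privates.segments_meet (H : Privates M y n) {i j k l : ℕ} (hij : i < j) (hjk : j < k)
    (hkl : k < l) (hl : l ≤ M) : ∃ o, o ∈ segment ℝ (y i) (y k) ∧ o ∈ segment ℝ (y j) (y l) := by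
  by_contra! hdisj
  obtain ⟨θ, hθ, hθ', hsep⟩ := exists_coord_lt_coord (convex_segment (y i) (y k))
    (segment_eq_image_lineMap ℝ (y i) (y k) ▸
      isCompact_Icc.image (AffineMap.lineMap_continuous))
    (convex_segment (y j) (y l))
    (segment_eq_image_lineMap ℝ (y j) (y l) ▸
      isCompact_Icc.image (AffineMap.lineMap_continuous)).isClosed
    (Set.disjoint_left.2 hdisj) (n i)
  have b₁ := H.beats (i := i) (j := k) (k := j) (l := l) (by omega) (by omega) hl
    (by omega) (by omega)
  have b₂ := H.beats (i := j) (j := l) (k := i) (l := k) (by omega) (by omega) (by omega)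
    (by omega) (by omega)
  have b₃ := H.beats (i := k) (j := i) (k := j) (l := l) (by omega) (by omega) hl
    (by omega) (by omega)
  have b₄ := H.beats (i := l) (j := j) (k := i) (l := k) (by omega) (by omega) (by omega)
    (by omega) (by omega)
  rw [segment_symm ℝ (y k)] at b₃
  rw [segment_symm ℝ (y l)] at b₄
  have h₀ : n 0 ≤ n i := by
    rcases Nat.eq_zero_or_pos i with rfl | h
    · rfl
    · exact (H.lt 0 i h (by omega)).le
  have h₁ : n l ≤ n M := by
    rcases hl.eq_or_lt with rfl | h
    · rfl
    · exact (H.lt l M h le_rfl).le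
  exact not_interlaced_of_separated hsep b₁ b₂ b₃ b₄ (H.lt i j hij (by omega)).le
    (H.lt j k hjk (by omega)).le (H.lt k l hkl hl).le (by linarith [H.le_two_pi]) hθ hθ'

theorem Privates.segments_meet_of_mem (H : Privates M y n) {p q r s : ℕ}
    (h₃ : q ≠ s) (h₄ : p < r ∧ r < q) (h₅ : ¬(p < s ∧ s < q)) (hps : p ≠ s) (h₆ : q ≤ M)
    (h₇ : s ≤ M) : ∃ o, o ∈ segment ℝ (y p) (y q) ∧ o ∈ segment ℝ (y r) (y s) := by
  rcases lt_or_ge q s with h | h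
  · exact H.segments_meet h₄.1 h₄.2 h h₇
  · obtain ⟨o, i₁, i₂⟩ := H.segments_meet (i := s) (j := p) (k := r) (l := q) (by omega) h₄.1
      h₄.2 h₆
    exact ⟨o, i₂, by rwa [segment_symm]⟩

theorem Privates.segments_meet_of_separates (H : Privates M y n) {p q u u' : ℕ}
    (h₂ : p ≠ u) (h₃ : p ≠ u') (h₄ : q ≠ u) (h₅ : q ≠ u') (hq : q ≤ M) (hu : u ≤ M) (hu' : u' ≤ M)
    (h : ¬((p < u ∧ u < q) ↔ (p < u' ∧ u' < q))) :
    ∃ o, o ∈ segment ℝ (y p) (y q) ∧ o ∈ segment ℝ (y u) (y u') := by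
  by_cases h' : p < u ∧ u < q
  · exact H.segments_meet_of_mem h₅ h' (fun h'' => h (iff_of_true h' h'')) h₃ hq hu'
  · obtain ⟨o, i₁, i₂⟩ := H.segments_meet_of_mem (r := u') h₄
      (by by_contra h''; exact h (iff_of_false h' h'')) h' h₂ hq hu
    exact ⟨o, i₁, by rwa [segment_symm]⟩

/-- Uncrossing two edges strictly shortens. -/
theorem Privates.dist_add_dist_lt (H : Privates M y n) {x x' u u' : ℕ} (hx : x ≤ M) (hx' : x' ≤ M)
    (hu : u ≤ M) (hu' : u' ≤ M) (h₁ : x ≠ x') (h₂ : x ≠ u) (h₃ : x ≠ u') (h₄ : x' ≠ u)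
    {o : Plane} (ho : o ∈ segment ℝ (y x) (y x')) (ho' : o ∈ segment ℝ (y u) (y u')) :
    dist (y x) (y u) + dist (y x') (y u') < dist (y x) (y x') + dist (y u) (y u') := by
  by_contra! hle
  have e₁ := dist_add_dist_of_mem_segment ho
  have e₂ := dist_add_dist_of_mem_segment ho'
  have t₁ := dist_triangle (y x) o (y u)
  have t₂ := dist_triangle (y x') o (y u')
  rw [dist_comm (y x') o] at t₂
  rw [dist_comm o (y u)] at t₁
  -- Without a gain the triangle inequalities are equalities, so o also lies on the segment from `y
  -- x` to `y u`. Either o is `y x`, or one of `y u`, `y x'` lies between `y x` and the other; each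
  -- contradicts a private direction.
  have e₃ : dist (y x) o + dist o (y u) = dist (y x) (y u) := by
    rw [dist_comm o (y u)]; linarith
  have ho₃ : o ∈ segment ℝ (y x) (y u) := by
    rw [mem_segment_iff_wbtw]; exact dist_add_dist_eq_iff.1 e₃
  rw [segment_eq_image_lineMap] at ho ho₃
  obtain ⟨t, ⟨ht₀, ht₁⟩, hto⟩ := ho
  obtain ⟨s, ⟨hs₀, hs₁⟩, hso⟩ := ho₃
  have hline : ∀ φ, t * (coord (y x') φ - coord (y x) φ) = s * (coord (y u) φ - coord (y x) φ) := by
    intro φ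
    have := congrArg (fun z => coord z φ) (hto.trans hso.symm)
    simp only [AffineMap.lineMap_apply, vsub_eq_sub, vadd_eq_add, coord_add_left, coord_smul,
      coord_sub_left] at this
    linarith
  rcases ht₀.eq_or_lt with rfl | ht
  · rw [AffineMap.lineMap_apply_zero] at hto
    have := coord_lt_of_mem_segment (H.not_sees u hu x hx h₂.symm)
      (H.not_sees u' hu' x hx h₃.symm) ho'
    rw [← hto] at this
    linarith [H.sees x hx]
  rcases le_total t s with hts | hts
  · have i₁ := hline (n u)
    have i₂ := H.sees u hu
    have i₃ := H.not_sees x hx u hu h₂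
    have i₄ := H.not_sees x' hx' u hu h₄
    nlinarith
  · have i₁ := hline (n x')
    have i₂ := H.sees x' hx'
    have i₃ := H.not_sees x hx x' hx' h₁
    have i₄ := H.not_sees u hu x' hx' h₄.symm
    have i₅ : 0 < (t - s) * (coord (y x') (n x') - coord (y x) (n x')) +
        s * (coord (y x') (n x') - coord (y u) (n x')) := by
      rcases hts.eq_or_lt with rfl | hts
      · rw [sub_self, zero_mul, zero_add]
        exact mul_pos ht (by linarith)
      · exact add_pos_of_pos_of_nonneg (mul_pos (by linarith) (by linarith))
          (mul_nonneg hs₀ (by linarith))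
    linarith

theorem exists_consecutive_ne {α : Type*} (f : α → Prop) : ∀ (l : List α) {a b : α}, a ∈ l → b ∈ l →
    f a → ¬f b → ∃ A x x' B, l = A ++ x :: x' :: B ∧ ¬(f x ↔ f x')
  | [], a, b, ha, _, _, _ => by simp at ha
  | [x], a, b, ha, hb, hfa, hfb => by
    rw [List.mem_singleton] at ha hb
    subst ha hb
    exact absurd hfa hfb
  | x :: x' :: l, a, b, ha, hb, hfa, hfb => by
    by_cases h : f x ↔ f x'
    · obtain ⟨a', ha', hfa'⟩ : ∃ a' ∈ x' :: l, f a' := by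
        rcases List.mem_cons.1 ha with rfl | ha
        · exact ⟨x', by simp, h.1 hfa⟩
        · exact ⟨a, ha, hfa⟩
      obtain ⟨b', hb', hfb'⟩ : ∃ b' ∈ x' :: l, ¬f b' := by
        rcases List.mem_cons.1 hb with rfl | hb
        · exact ⟨x', by simp, fun h' => hfb (h.2 h')⟩
        · exact ⟨b, hb, hfb⟩
      obtain ⟨A, u, u', B, e, hne⟩ := exists_consecutive_ne f (x' :: l) ha' hb' hfa' hfb'
      exact ⟨x :: A, u, u', B, by rw [e]; rfl, hne⟩
    · exact ⟨[], x, x', l, rfl, h⟩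

/-- Reversing the stretch from x' to u only exchanges the edges xx' and uu' for xu and x'u'. -/
theorem pathLength_reverse_middle (A B C : List Plane) (x x' u u' : Plane) :
    pathLength (A ++ x :: ((x' :: B ++ [u]).reverse ++ u' :: C)) + dist x x' + dist u u' =
      pathLength (A ++ x :: (x' :: B ++ u :: u' :: C)) + dist x u + dist x' u' := by
  have h₁ := pathLength_reverse (x' :: B ++ [u])
  have h₂ : (x' :: B ++ [u]).reverse = u :: B.reverse ++ [x'] := by simp
  have h₃ : x :: ((u :: B.reverse ++ [x']) ++ u' :: C) =
    x :: u :: (B.reverse ++ x' :: u' :: C) := by simp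
  have h₄ : x :: (x' :: B ++ u :: u' :: C) = x :: x' :: (B ++ u :: u' :: C) := by simp
  rw [h₂] at h₁
  rw [h₂, h₃, pathLength_append, h₄, pathLength_append x (x' :: _) A, pathLength_cons_cons,
    pathLength_cons_cons x x']
  have e₁ := pathLength_append x' (u' :: C) (u :: B.reverse)
  have e₂ := pathLength_append u (u' :: C) (x' :: B)
  simp only [List.cons_append, pathLength_cons_cons] at e₁ e₂ h₁ ⊢
  rw [e₁, e₂, h₁]
  ring

/-- Among the orders in which the points can be visited, the shortest ones are not
interlacing. -/
theorem Privates.nonInterlacing (H : Privates M y n) {L : List ℕ}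
    (hL : L.Perm (List.range (M + 1)))
    (hmin : ∀ L' : List ℕ, L'.Perm L →
      pathLength (0 :: L.map y) ≤ pathLength (0 :: L'.map y)) : NonInterlacing L := by
  have hnd : L.Nodup := hL.nodup_iff.2 List.nodup_range
  have hle : ∀ i ∈ L, i ≤ M := fun i hi => Nat.lt_succ_iff.1 (List.mem_range.1 (hL.mem_iff.1 hi))
  suffices key : ∀ P Q, L = P ++ Q → ∀ a b c d, c < d → a ∈ P → b ∈ P → c ∈ Q → d ∈ Q →
      (c < a ∧ a < d) → ¬(c < b ∧ b < d) → False by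
    intro P Q hPQ i j k l hij hjk hkl
    exact ⟨fun ⟨hi, hj, hk, hl⟩ => key P Q hPQ k i j l (by omega) hk hi hj hl (by omega) (by omega),
      fun ⟨hi, hj, hk, hl⟩ => key P Q hPQ j l i k (by omega) hj hl hi hk (by omega) (by omega)⟩
  rintro P Q rfl a b c d hcd ha hb hc hd hac hbc
  have hdisj : ∀ {i j}, i ∈ P → j ∈ Q → i ≠ j := by
    rintro i j hi hj rfl
    exact (List.nodup_append.1 hnd).2.2 _ hi _ hj rfl
  -- Interlacing sets give interlacing edges: some edge of P passes from inside (c, d) to outside,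
  -- so its ends separate c from d, and then some edge of Q passes between the two sides of that
  -- edge.
  obtain ⟨P₁, x, x', P₂, rfl, hx⟩ := exists_consecutive_ne (fun e => c < e ∧ e < d) P ha hb hac hbc
  have hxc := hdisj (i := x) (by simp) hc
  have hxd := hdisj (i := x) (by simp) hd
  have hxc' := hdisj (i := x') (by simp) hc
  have hxd' := hdisj (i := x') (by simp) hd
  have hcd' : ¬((min x x' < c ∧ c < max x x') ↔ (min x x' < d ∧ d < max x x')) := by omega
  obtain ⟨Q₁, u, u', Q₂, rfl, hu⟩ : ∃ Q₁ u u' Q₂, Q = Q₁ ++ u :: u' :: Q₂ ∧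
      ¬((min x x' < u ∧ u < max x x') ↔ (min x x' < u' ∧ u' < max x x')) := by
    by_cases h : min x x' < c ∧ c < max x x'
    · exact exists_consecutive_ne (fun e => min x x' < e ∧ e < max x x') Q hc hd h
        fun h' => hcd' (iff_of_true h h')
    · exact exists_consecutive_ne (fun e => min x x' < e ∧ e < max x x') Q hd hc
        (by by_contra h'; exact hcd' (iff_of_false h h')) h
  have n₁ := hdisj (i := x) (j := u) (by simp) (by simp)
  have n₂ := hdisj (i := x) (j := u') (by simp) (by simp)
  have n₃ := hdisj (i := x') (j := u) (by simp) (by simp)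
  have n₄ := hdisj (i := x') (j := u') (by simp) (by simp)
  have m₁ := hle x (by simp)
  have m₂ := hle x' (by simp)
  have m₃ := hle u (by simp)
  have m₄ := hle u' (by simp)
  have n₅ : x ≠ x' := fun h => by subst h; exact hx Iff.rfl
  obtain ⟨o, ho, ho'⟩ : ∃ o, o ∈ segment ℝ (y x) (y x') ∧ o ∈ segment ℝ (y u) (y u') := by
    rcases lt_or_gt_of_ne n₅ with h | h
    · exact H.segments_meet_of_separates n₁ n₂ n₃ n₄ m₂ m₃ m₄ (by rwa [min_eq_left h.le, max_eq_right h.le] at hu)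
    · obtain ⟨o, i₁, i₂⟩ := H.segments_meet_of_separates n₃ n₄ n₁ n₂ m₁ m₃ m₄
        (by rwa [min_eq_right h.le, max_eq_left h.le] at hu)
      exact ⟨o, by rwa [segment_symm], i₂⟩
  have hlt := H.dist_add_dist_lt m₁ m₂ m₃ m₄ n₅ n₁ n₂ n₃ ho ho'
  have hperm : (P₁ ++ x :: ((x' :: (P₂ ++ Q₁) ++ [u]).reverse ++ u' :: Q₂)).Perm
      (P₁ ++ x :: x' :: P₂ ++ (Q₁ ++ u :: u' :: Q₂)) := by
    have e : P₁ ++ x :: x' :: P₂ ++ (Q₁ ++ u :: u' :: Q₂) =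
      P₁ ++ x :: ((x' :: (P₂ ++ Q₁) ++ [u]) ++ u' :: Q₂) := by simp
    rw [e]
    exact ((List.Perm.append_right _ (List.reverse_perm _)).cons _).append_left _
  have h₁ := hmin _ hperm
  have h₂ := pathLength_reverse_middle (0 :: P₁.map y) ((P₂ ++ Q₁).map y) (Q₂.map y)
    (y x) (y x') (y u) (y u')
  simp only [List.map_append, List.map_cons, List.map_reverse, List.map_nil, List.cons_append,
    List.append_assoc] at h₁ h₂
  linarith

end Crossing

/-! ### Tiling the arc -/

/-- Inspection of an interval with one moving end is parametrised by the fixed interval [0, 1],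
which makes it visibly a closed condition on that end. -/
theorem isClosed_setOf_covers (z : Plane) (u v : ℝ) :
    IsClosed {φ | ∀ t ∈ Icc (0 : ℝ) 1, 1 ≤ coord z (u + t * (φ - v))} := by
  simp only [ofPred_forall]
  refine isClosed_iInter fun t => isClosed_iInter fun _ => ?_
  exact isClosed_le continuous_const ((continuous_coord z).comp (by fun_prop))

theorem covers_iff_left {a φ : ℝ} (h : a ≤ φ) (z : Plane) :
    Covers a φ z ↔ ∀ t ∈ Icc (0 : ℝ) 1, 1 ≤ coord z (a + t * (φ - a)) := by
  refine ⟨fun H t ht => H _ (by nlinarith [ht.1]) (by nlinarith [ht.2]), fun H ψ h₁ h₂ => ?_⟩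
  rcases h.eq_or_lt with rfl | h
  · have := H 0 (by simp)
    rwa [zero_mul, add_zero, ← le_antisymm h₂ h₁] at this
  · have := H ((ψ - a) / (φ - a))
      ⟨div_nonneg (by linarith) (by linarith), (div_le_one (by linarith)).2 (by linarith)⟩
    rwa [div_mul_cancel₀ _ (by linarith), add_sub_cancel] at this

theorem covers_iff_right {a φ : ℝ} (h : φ ≤ a) (z : Plane) :
    Covers φ a z ↔ ∀ t ∈ Icc (0 : ℝ) 1, 1 ≤ coord z (a + t * (φ - a)) := by
  refine ⟨fun H t ht => H _ (by nlinarith [ht.2]) (by nlinarith [ht.1]), fun H ψ h₁ h₂ => ?_⟩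
  rcases h.eq_or_lt with rfl | h
  · have := H 0 (by simp)
    rwa [zero_mul, add_zero, ← le_antisymm h₂ h₁] at this
  · have := H ((a - ψ) / (a - φ))
      ⟨div_nonneg (by linarith) (by linarith), (div_le_one (by linarith)).2 (by linarith)⟩
    convert this using 2
    field_simp [show a - φ ≠ 0 by linarith]
    ring

/-- Two nonempty closed sets covering a connected interval have a common point. -/
theorem exists_breakpoint {u v : ℝ} {p q : Plane} (huv : u ≤ v) (hp : 1 ≤ coord p u)
    (hq : 1 ≤ coord q v) (h : ∀ φ, u ≤ φ → φ ≤ v → Covers u φ p ∨ Covers φ v q) :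
    ∃ s, u ≤ s ∧ s ≤ v ∧ Covers u s p ∧ Covers s v q := by
  obtain ⟨s, hs, hs₁, hs₂⟩ := isPreconnected_closed_iff.1 (isPreconnected_Icc (a := u) (b := v))
    _ _ (isClosed_setOf_covers p u u) (isClosed_setOf_covers q v v)
    (fun φ hφ => (h φ hφ.1 hφ.2).imp (covers_iff_left hφ.1 p).1 (covers_iff_right hφ.2 q).1)
    ⟨u, left_mem_Icc.2 huv, (covers_iff_left le_rfl p).1 (covers_singleton hp)⟩
    ⟨v, right_mem_Icc.2 huv, (covers_iff_right le_rfl q).1 (covers_singleton hq)⟩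
  exact ⟨s, hs.1, hs.2, (covers_iff_left hs.1 p).2 hs₁, (covers_iff_right hs.2 q).2 hs₂⟩

section Tiling

variable {M : ℕ} {y : ℕ → Plane} {n : ℕ → ℝ}

theorem Privates.le (H : Privates M y n) {i j : ℕ} (hij : i ≤ j) (hj : j ≤ M) : n i ≤ n j := by
  rcases hij.eq_or_lt with rfl | h
  · rfl
  · exact (H.lt i j h hj).le

/-- The points other than the `i`-th and the `(i+1)`-st do not inspect anything between the
private directions of these two. -/
theorem Privates.covers_between (H : Privates M y n) {i : ℕ} (hi : i < M) {φ : ℝ} (h₁ : n i ≤ φ)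
    (h₂ : φ ≤ n (i + 1)) (h : ∃ j ≤ M, 1 ≤ coord (y j) φ) :
    Covers (n i) φ (y i) ∨ Covers φ (n (i + 1)) (y (i + 1)) := by
  obtain ⟨j, hj, hjφ⟩ := h
  have b₀ : ∀ k ≤ M, n 0 ≤ n k := fun k hk => H.le (Nat.zero_le k) hk
  have b₁ : ∀ k ≤ M, n k ≤ n M := fun k hk => H.le hk le_rfl
  have hM := H.le_two_pi
  have d₁ := b₀ i hi.le
  have d₂ := b₀ j hj
  have d₃ := b₁ j hj
  have d₄ := b₁ (i + 1) hi
  have hsj := H.sees j hj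
  have hni : i ≠ j → ¬1 ≤ coord (y j) (n i) := fun h =>
    not_le.2 (H.not_sees j hj i hi.le h.symm)
  have hni' : i + 1 ≠ j → ¬1 ≤ coord (y j) (n (i + 1)) := fun h =>
    not_le.2 (H.not_sees j hj (i + 1) hi h.symm)
  rcases le_or_gt j i with hji | hji
  · have hle := H.le hji hi.le
    rcases covers_or_covers_compl hsj hjφ with hc | hc
    · rcases hji.eq_or_lt with rfl | hji
      · exact Or.inl hc
      · exact (hni hji.ne' (hc _ hle h₁)).elim
    · exact (hni' (by omega) (hc _ h₂ (by linarith))).elim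
  · have hle := H.le (Nat.succ_le_of_lt hji) hj
    rcases covers_or_covers_compl hjφ hsj with hc | hc
    · by_cases hji' : i + 1 = j
      · subst hji'; exact Or.inr hc
      · exact (hni' hji' (hc _ h₂ hle)).elim
    · refine (hni hji.ne ?_).elim
      rw [← coord_add_two_pi]
      exact hc _ (by linarith) (by linarith)

theorem Privates.covers_first (H : Privates M y n) (hM : 0 < M) {φ : ℝ} (h₁ : n M ≤ φ + 2 * Real.pi)
    (h₂ : φ ≤ n 0) (h : ∃ j ≤ M, 1 ≤ coord (y j) φ) :
    Covers φ (n 0) (y 0) ∨ Covers (n M) (φ + 2 * Real.pi) (y M) := by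
  obtain ⟨j, hj, hjφ⟩ := h
  have d₁ := H.le (Nat.zero_le j) hj
  have d₂ := H.le hj le_rfl
  rcases covers_or_covers_compl hjφ (H.sees j hj) with hc | hc
  · by_cases hj0 : j = 0
    · subst hj0; exact Or.inl hc
    · linarith [hc _ h₂ d₁, H.not_sees j hj 0 (Nat.zero_le M) hj0]
  · by_cases hjM : j = M
    · subst hjM; exact Or.inr hc
    · linarith [hc _ d₂ h₁, H.not_sees j hj M le_rfl hjM]

theorem Privates.covers_last (H : Privates M y n) (hM : 0 < M) {φ : ℝ} (h₁ : φ ≤ n 0 + 2 * Real.pi)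
    (h₂ : n M ≤ φ) (h : ∃ j ≤ M, 1 ≤ coord (y j) φ) :
    Covers (n M) φ (y M) ∨ Covers φ (n 0 + 2 * Real.pi) (y 0) := by
  obtain ⟨j, hj, hjφ⟩ := h
  have d₁ := H.le (Nat.zero_le j) hj
  have d₂ := H.le hj le_rfl
  rcases covers_or_covers_compl (H.sees j hj) hjφ with hc | hc
  · by_cases hjM : j = M
    · subst hjM; exact Or.inl hc
    · linarith [hc _ d₂ h₂, H.not_sees j hj M le_rfl hjM]
  · by_cases hj0 : j = 0
    · subst hj0; exact Or.inr hc
    · have h₃ := hc _ h₁ (by linarith)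
      rw [coord_add_two_pi] at h₃
      linarith [H.not_sees j hj 0 (Nat.zero_le M) hj0]

theorem Privates.exists_tiling (H : Privates M y n) {u v : ℝ}
    (hcov : ∀ φ, n 0 ≤ φ → φ ≤ n M → ∃ j ≤ M, 1 ≤ coord (y j) φ)
    (hu : u ≤ n 0) (hv : n M ≤ v) (hu' : Covers u (n 0) (y 0)) (hv' : Covers (n M) v (y M))
    (hl : 5 * Real.pi / 6 ≤ v - u) (hl' : v - u ≤ 2 * Real.pi) :
    ∃ b, Tiling M y b n ∧ b 0 = u ∧ b (M + 1) = v := by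
  have hex : ∀ i, ∃ s, i < M → n i ≤ s ∧ s ≤ n (i + 1) ∧ Covers (n i) s (y i) ∧
      Covers s (n (i + 1)) (y (i + 1)) := by
    intro i
    by_cases hi : i < M
    · obtain ⟨s, hs⟩ := exists_breakpoint (H.lt i (i + 1) (by omega) hi).le (H.sees i hi.le)
        (H.sees (i + 1) hi) fun φ h₁ h₂ => H.covers_between hi h₁ h₂
          (hcov φ ((H.le (Nat.zero_le i) hi.le).trans h₁) (h₂.trans (H.le hi le_rfl)))
      exact ⟨s, fun _ => hs⟩
    · exact ⟨0, fun h => absurd h hi⟩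
  choose s hs using hex
  -- The break between the ranks i and i + 1 is `b (i + 1)`; beyond M the sequence stays at v so as
  -- to be monotone on all of ℕ.
  obtain ⟨b, hb⟩ : ∃ b : ℕ → ℝ, ∀ i, b i = if i = 0 then u else if i ≤ M then s (i - 1) else v :=
    ⟨_, fun _ => rfl⟩
  have b0 : b 0 = u := by simp [hb]
  have bl : ∀ i, M < i → b i = v := fun i hi => by
    rw [hb, if_neg (by omega), if_neg (by omega)]
  have bm : ∀ i, i < M → b (i + 1) = s i := fun i hi => by
    rw [hb, if_neg (by omega), if_pos (by omega), Nat.add_sub_cancel]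
  have left : ∀ i ≤ M, b i ≤ n i ∧ Covers (b i) (n i) (y i) := by
    rintro (_ | i) hi
    · rw [b0]; exact ⟨hu, hu'⟩
    · rw [bm i hi]; exact ⟨(hs i hi).2.1, (hs i hi).2.2.2⟩
  have right : ∀ i ≤ M, n i ≤ b (i + 1) ∧ Covers (n i) (b (i + 1)) (y i) := by
    intro i hi
    rcases hi.eq_or_lt with rfl | hi
    · rw [bl _ (by omega)]; exact ⟨hv, hv'⟩
    · rw [bm i hi]; exact ⟨(hs i hi).1, (hs i hi).2.2.1⟩
  refine ⟨b, ⟨monotone_nat_of_le_succ fun i => ?_, fun i hi => (left i hi).2.union (right i hi).2,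
    fun i hi => (left i hi).1, fun i hi => (right i hi).1, H.not_sees, ?_, ?_⟩, b0, bl _ (by omega)⟩
  · rcases le_or_gt i M with hi | hi
    · exact (left i hi).1.trans (right i hi).1
    · rw [bl i hi, bl (i + 1) (by omega)]
  · rwa [b0, bl _ (by omega)]
  · rwa [b0, bl _ (by omega)]

/-- An end of the arc may be inspected only by the point of the opposite extreme rank, looking
across the seam outside the arc. Then the seam is inspected as well; cutting the circle at a
breakpoint s in it, the same ranks tile a full turn, which only strengthens the bound. -/
theorem Privates.exists_tiling_of_covering (H : Privates M y n) {u v : ℝ} (hu : u ≤ n 0)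
    (hv : n M ≤ v) (hl : 5 * Real.pi / 6 ≤ v - u) (hl' : v - u ≤ 2 * Real.pi)
    (hcov : ∀ φ, u ≤ φ → φ ≤ v → ∃ j ≤ M, 1 ≤ coord (y j) φ) :
    ∃ b, Tiling M y b n ∧ v - u ≤ b (M + 1) - b 0 := by
  have hpi := Real.pi_pos
  have hcov' : ∀ φ, n 0 ≤ φ → φ ≤ n M → ∃ j ≤ M, 1 ≤ coord (y j) φ := fun φ h₁ h₂ =>
    hcov φ (hu.trans h₁) (h₂.trans hv)
  have h0M := H.le (Nat.zero_le M) le_rfl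
  rcases Nat.eq_zero_or_pos M with rfl | hM
  · have hc : Covers u v (y 0) := fun φ h₁ h₂ => by
      obtain ⟨j, hj, h⟩ := hcov φ h₁ h₂
      rwa [Nat.le_zero.1 hj] at h
    obtain ⟨b, hb, rfl, rfl⟩ := H.exists_tiling hcov' hu hv (hc.mono le_rfl hv) (hc.mono hu le_rfl)
      hl hl'
    exact ⟨b, hb, le_rfl⟩
  have hgood : Covers u (n 0) (y 0) → Covers (n M) v (y M) →
      ∃ b, Tiling M y b n ∧ v - u ≤ b (M + 1) - b 0 := fun h₁ h₂ => by
    obtain ⟨b, hb, rfl, rfl⟩ := H.exists_tiling hcov' hu hv h₁ h₂ hl hl'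
    exact ⟨b, hb, le_rfl⟩
  have hseam : (∀ φ, n M ≤ φ → φ ≤ n 0 + 2 * Real.pi →
      Covers (n M) φ (y M) ∨ Covers φ (n 0 + 2 * Real.pi) (y 0)) →
      ∃ b, Tiling M y b n ∧ v - u ≤ b (M + 1) - b 0 := fun h => by
    obtain ⟨s, h₁, h₂, h₃, h₄⟩ := exists_breakpoint H.le_two_pi (H.sees M le_rfl)
      (by rw [coord_add_two_pi]; exact H.sees 0 (Nat.zero_le M)) h
    obtain ⟨b, hb, hb₀, hb₁⟩ := H.exists_tiling (u := s - 2 * Real.pi) (v := s) hcov'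
      (by linarith) h₁ (fun φ i₁ i₂ => by
        rw [← coord_add_two_pi]; exact h₄ _ (by linarith) (by linarith)) h₃
      (by linarith) (by linarith)
    exact ⟨b, hb, by linarith⟩
  have hlast := H.covers_last hM (φ := v) (by linarith) hv (hcov v (by linarith) le_rfl)
  have hfirst := H.covers_first hM (φ := u) (by linarith) hu (hcov u le_rfl (by linarith))
  rcases hfirst with hfirst | hfirst
  · rcases hlast with hlast | hlast
    · exact hgood hfirst hlast
    · refine hseam fun φ h₁ h₂ => ?_
      rcases le_total φ v with h | h
      · exact H.covers_last hM h₂ h₁ (hcov φ (by linarith) h)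
      · exact Or.inr (hlast.mono h le_rfl)
  · refine hseam fun φ h₁ h₂ => ?_
    rcases le_total φ (u + 2 * Real.pi) with h | h
    · exact Or.inl (hfirst.mono le_rfl h)
    · refine H.covers_last hM h₂ h₁ ?_
      obtain ⟨j, hj, hj'⟩ := hcov (φ - 2 * Real.pi) (by linarith) (by linarith)
      exact ⟨j, hj, by rwa [coord_sub_two_pi] at hj'⟩

/-! ### Finite sets of positions inspecting an arc -/

theorem pathLength_cons_le (p a : Plane) (l : List Plane) :
    pathLength (p :: l) ≤ dist p a + pathLength (a :: l) := by
  cases l with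
  | nil => simp
  | cons b l =>
    simp only [pathLength_cons_cons]
    linarith [dist_triangle p a b]

theorem pathLength_le_of_sublist {l l' : List Plane} (h : l.Sublist l') (p : Plane) :
    pathLength (p :: l) ≤ pathLength (p :: l') := by
  induction h generalizing p with
  | slnil => rfl
  | cons a _ ih =>
    rw [pathLength_cons_cons]
    exact (pathLength_cons_le p a _).trans (by gcongr; exact ih a)
  | cons_cons a _ ih =>
    rw [pathLength_cons_cons, pathLength_cons_cons]
    gcongr
    exact ih a

/-- A list of positions from which all the directions between `u` and `v` are inspected. -/
def CoversArc (u v : ℝ) (l : List Plane) : Prop :=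
  ∀ φ, u ≤ φ → φ ≤ v → ∃ p ∈ l, 1 ≤ coord p φ

/-- Among the covering lists that are no longer as paths, one with the fewest points is taken.
Deleting a point does not lengthen the path, so it must uncover some direction, which is private to
that point. -/
theorem exists_privates {u v : ℝ} (huv : u ≤ v) (hl' : v - u ≤ 2 * Real.pi) {l : List Plane}
    (hl : CoversArc u v l) : ∃ (M : ℕ) (y : ℕ → Plane) (n : ℕ → ℝ) (L : List ℕ),
      Privates M y n ∧ u ≤ n 0 ∧ n M ≤ v ∧ L.Perm (List.range (M + 1)) ∧
      CoversArc u v (L.map y) ∧ pathLength (0 :: L.map y) ≤ pathLength (0 :: l) := by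
  classical
  have hex : ∃ N, ∃ l' : List Plane, l'.length = N ∧ CoversArc u v l' ∧
      pathLength (0 :: l') ≤ pathLength (0 :: l) := ⟨_, l, rfl, hl, le_rfl⟩
  obtain ⟨l', hlen, hcov, hcost⟩ := Nat.find_spec hex
  have hmin := fun m => Nat.find_min hex (m := m)
  rw [← hlen] at hmin
  clear hlen hex
  have hpriv : ∀ i : Fin l'.length, ∃ φ, u ≤ φ ∧ φ ≤ v ∧ 1 ≤ coord l'[i] φ ∧
      ∀ j : Fin l'.length, j ≠ i → coord l'[j] φ < 1 := by
    intro i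
    have h := hmin (l'.eraseIdx i).length (by
      rw [List.length_eraseIdx_of_lt i.2]; have := i.2; omega)
    push Not at h
    have h₂ : ¬CoversArc u v (l'.eraseIdx i) := fun h' => not_le.2 (h _ rfl h')
      ((pathLength_le_of_sublist (List.eraseIdx_sublist _ _) 0).trans hcost)
    unfold CoversArc at h₂
    push Not at h₂
    obtain ⟨φ, h₁, h₂, h₃⟩ := h₂
    have h₄ : ∀ j : Fin l'.length, j ≠ i → coord l'[j] φ < 1 := fun j hj =>
      h₃ _ (List.mem_eraseIdx_iff_getElem.2 ⟨j, j.2, fun h => hj (Fin.ext h), rfl⟩)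
    refine ⟨φ, h₁, h₂, ?_, h₄⟩
    obtain ⟨p, hp, hpφ⟩ := hcov φ h₁ h₂
    obtain ⟨j, hj, rfl⟩ := List.mem_iff_getElem.1 hp
    by_cases hji : (⟨j, hj⟩ : Fin l'.length) = i
    · rw [← hji]; exact hpφ
    · linarith [h₄ _ hji, show 1 ≤ coord l'[(⟨j, hj⟩ : Fin l'.length)] φ from hpφ]
  choose ν hν₁ hν₂ hν₃ hν₄ using hpriv
  have hpos : 0 < l'.length := by
    obtain ⟨p, hp, -⟩ := hcov u le_rfl huv
    exact List.length_pos_of_mem hp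
  obtain ⟨M, hM⟩ : ∃ M, l'.length = M + 1 := ⟨l'.length - 1, by omega⟩
  have hinj : Function.Injective ν := fun i j hij => by
    by_contra hne
    linarith [hν₄ i j (Ne.symm hne), hij ▸ hν₃ j]
  obtain ⟨σ, hσ⟩ : ∃ σ : Equiv.Perm (Fin l'.length), StrictMono (ν ∘ σ) :=
    ⟨Tuple.sort ν, (Tuple.monotone_sort ν).strictMono_of_injective
      (hinj.comp (Equiv.injective _))⟩
  obtain ⟨y, hy⟩ : ∃ y : ℕ → Plane, ∀ i : Fin l'.length, y i = l'[σ i] :=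
    ⟨fun i => if h : i < l'.length then l'[σ ⟨i, h⟩] else 0, fun i => by simp⟩
  obtain ⟨n, hn⟩ : ∃ n : ℕ → ℝ, ∀ i : Fin l'.length, n i = ν (σ i) :=
    ⟨fun i => if h : i < l'.length then ν (σ ⟨i, h⟩) else 0, fun i => by simp⟩
  have hyn : ∀ i ≤ M, ∃ i' : Fin l'.length, (i' : ℕ) = i := fun i hi => ⟨⟨i, by omega⟩, rfl⟩
  -- As σ sends ranks to positions in the list, σ⁻¹ lists the ranks in order of visit.
  have hL : (List.ofFn fun i => ((σ.symm i : Fin l'.length) : ℕ)).map y = l' := by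
    rw [List.map_ofFn]
    conv_rhs => rw [← List.ofFn_getElem (xs := l')]
    congr 1
    funext i
    simp [hy]
  refine ⟨M, y, n, List.ofFn fun i => ((σ.symm i : Fin l'.length) : ℕ), ⟨?_, ?_, ?_, ?_⟩, ?_, ?_,
    ?_, ?_, ?_⟩
  · intro i j hij hj
    obtain ⟨i, rfl⟩ := hyn i (by omega)
    obtain ⟨j, rfl⟩ := hyn j hj
    rw [hn, hn]
    exact hσ (Fin.lt_def.2 hij)
  · obtain ⟨i, hi⟩ := hyn M le_rfl
    obtain ⟨j, hj⟩ := hyn 0 (Nat.zero_le M)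
    have e₁ := hn i
    have e₂ := hn j
    rw [hi] at e₁
    rw [hj] at e₂
    linarith [hν₁ (σ j), hν₂ (σ i)]
  · intro i hi
    obtain ⟨i, rfl⟩ := hyn i hi
    rw [hy, hn]
    exact hν₃ _
  · intro i hi j hj hij
    obtain ⟨i, rfl⟩ := hyn i hi
    obtain ⟨j, rfl⟩ := hyn j hj
    rw [hy, hn]
    exact hν₄ _ _ fun h => hij (congrArg _ (σ.injective h))
  · obtain ⟨j, hj⟩ := hyn 0 (Nat.zero_le M)
    rw [← hj, hn]
    exact hν₁ _
  · obtain ⟨i, hi⟩ := hyn M le_rfl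
    rw [← hi, hn]
    exact hν₂ _
  · refine (List.perm_ext_iff_of_nodup ?_ List.nodup_range).2 fun i => ?_
    · exact List.nodup_ofFn.2 fun i j h => σ.symm.injective (Fin.ext h)
    · rw [List.mem_ofFn', List.mem_range, ← hM]
      exact ⟨fun ⟨j, hj⟩ => hj ▸ (σ.symm j).2, fun h => ⟨σ ⟨i, h⟩, by simp⟩⟩
  · rwa [hL]
  · rwa [hL]

theorem CoversArc.lower_bound {u v : ℝ} (hl : 5 * Real.pi / 6 ≤ v - u)
    (hl' : v - u ≤ 2 * Real.pi) {l : List Plane} (h : CoversArc u v l) :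
    1 + Real.sqrt 3 + (v - u) - 5 * Real.pi / 6 ≤ pathLength (0 :: l) := by
  classical
  obtain ⟨M, y, n, L, H, hu, hv, hL, hcov, hcost⟩ :=
    exists_privates (by linarith [Real.pi_pos]) hl' h
  obtain ⟨L', hL', hmin⟩ := L.permutations.toFinset.exists_min_image
    (fun L => pathLength (0 :: L.map y)) ⟨L, by simp⟩
  simp only [List.mem_toFinset, List.mem_permutations] at hL' hmin
  have hNI := H.nonInterlacing (hL'.trans hL) fun L'' hL'' => hmin _ (hL''.trans hL')
  obtain ⟨b, T, hb⟩ := H.exists_tiling_of_covering hu hv hl hl' fun φ h₁ h₂ => by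
    obtain ⟨p, hp, hpφ⟩ := hcov φ h₁ h₂
    obtain ⟨j, hj, rfl⟩ := List.mem_map.1 hp
    exact ⟨j, Nat.lt_succ_iff.1 (List.mem_range.1 (hL.mem_iff.1 hj)), hpφ⟩
  have h₁ := T.lower_bound (hL'.trans hL) hNI
  have h₂ := hmin L (List.Perm.refl L)
  linarith

end Tiling

/-! ### Trajectories -/

theorem norm_perimeterPoint (φ : ℝ) : ‖perimeterPoint φ‖ = 1 := by
  rw [← sq_eq_sq₀ (norm_nonneg _) zero_le_one, norm_sq_eq _ φ, coord_perimeterPoint,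
    coord_perimeterPoint]
  simp

theorem inspects_iff (A : Plane) (φ : ℝ) : Inspects A (perimeterPoint φ) ↔ 1 ≤ coord A φ := by
  constructor
  · intro h
    by_contra! hlt
    have hD : 0 < ‖A - perimeterPoint φ‖ ^ 2 := by
      have : A - perimeterPoint φ ≠ 0 := fun h0 => by
        rw [sub_eq_zero.1 h0, coord_perimeterPoint, sub_self, Real.cos_zero] at hlt
        exact lt_irrefl _ hlt
      positivity
    -- At the fraction t of the way from P to A the squared norm is 1 - 2t(1 - coord A φ) + t²|A -
    -- P|², which is below 1 for this t.
    obtain ⟨t, ht₀, ht₁, ht⟩ : ∃ t : ℝ, 0 < t ∧ t ≤ 1 ∧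
        t * ‖A - perimeterPoint φ‖ ^ 2 ≤ 1 - coord A φ := by
      refine ⟨min 1 ((1 - coord A φ) / ‖A - perimeterPoint φ‖ ^ 2),
        lt_min one_pos (div_pos (by linarith) hD), min_le_left _ _, ?_⟩
      rw [← le_div_iff₀ hD]
      exact min_le_right _ _
    have hm : t • A + (1 - t) • perimeterPoint φ ∈ segment ℝ A (perimeterPoint φ) :=
      ⟨t, 1 - t, ht₀.le, by linarith, by ring, rfl⟩
    refine Set.disjoint_left.1 h hm ?_
    rw [mem_ball_zero_iff, ← sq_lt_one_iff₀ (norm_nonneg _)]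
    rw [norm_sq_eq _ φ] at ht ⊢
    simp only [coord_add_left, coord_sub_left, coord_smul, coord_perimeterPoint, sub_self,
      Real.cos_zero] at ht ⊢
    have e : Real.cos (φ - (φ + Real.pi / 2)) = 0 := by
      rw [sub_add_cancel_left, Real.cos_neg, Real.cos_pi_div_two]
    rw [e] at ht ⊢
    nlinarith
  · intro h
    refine Set.disjoint_left.2 ?_
    rintro _ ⟨a, b, ha, hb, hab, rfl⟩ hlt
    rw [mem_ball_zero_iff] at hlt
    have h₁ := coord_le_norm (a • A + b • perimeterPoint φ) φ
    simp only [coord_add_left, coord_smul, coord_perimeterPoint, sub_self, Real.cos_zero] at h₁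
    nlinarith

theorem IsTrajectory.dist_le {γ : ℝ → Plane} (hγ : IsTrajectory γ) {s t : ℝ} (hs : 0 ≤ s)
    (hst : s ≤ t) : dist (γ s) (γ t) ≤ t - s := by
  have h₁ : edist (γ s) (γ t) ≤ eVariationOn γ (Ici 0 ∩ Icc s t) :=
    eVariationOn.edist_le γ ⟨hs, left_mem_Icc.2 hst⟩ ⟨hs.trans hst, right_mem_Icc.2 hst⟩
  rw [hγ.unitSpeed (mem_Ici.2 hs) (mem_Ici.2 (hs.trans hst)), edist_dist] at h₁
  simpa using (ENNReal.ofReal_le_ofReal_iff (by simpa using hst)).1 h₁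

theorem IsTrajectory.norm_le {γ : ℝ → Plane} (hγ : IsTrajectory γ) {t : ℝ} (ht : 0 ≤ t) :
    ‖γ t‖ ≤ t := by
  simpa [hγ.start] using hγ.dist_le le_rfl ht

/-- A time strictly between the supremum and T would exceed an actual inspection time of every
direction, so attainment of the infima is not needed. -/
theorem le_worstCaseTime {γ : ℝ → Plane} {α c T : ℝ}
    (h : ∀ τ, (∀ φ, α ≤ φ → φ ≤ α + c → ∃ t, 0 ≤ t ∧ t < τ ∧ 1 ≤ coord (γ t) φ) → T ≤ τ) :
    ENNReal.ofReal T ≤ worstCaseTime γ (perimeterArc α c) := by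
  by_contra! hlt
  obtain ⟨τ, hτ₁, hτ₂⟩ := exists_between hlt
  have hτ : τ ≠ ⊤ := (hτ₂.trans_le le_top).ne
  rw [← ENNReal.ofReal_toReal hτ] at hτ₁ hτ₂
  refine not_le.2 hτ₂ (ENNReal.ofReal_le_ofReal (h _ fun φ h₁ h₂ => ?_))
  have h₃ : inspectionTime γ (perimeterPoint φ) < ENNReal.ofReal τ.toReal :=
    (le_iSup₂ (f := fun P (_ : P ∈ perimeterArc α c) => inspectionTime γ P) _
      ⟨φ, ⟨h₁, h₂⟩, rfl⟩).trans_lt hτ₁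
  simp only [inspectionTime, iInf_lt_iff] at h₃
  obtain ⟨t, ⟨ht, hi⟩, hlt⟩ := h₃
  exact ⟨t, ht, (ENNReal.ofReal_lt_ofReal_iff_of_nonneg ht).1 hlt, (inspects_iff _ _).1 hi⟩

theorem worstCaseTime_le {γ : ℝ → Plane} {α c T : ℝ}
    (h : ∀ φ, α ≤ φ → φ ≤ α + c → ∃ t, 0 ≤ t ∧ t ≤ T ∧ 1 ≤ coord (γ t) φ) :
    worstCaseTime γ (perimeterArc α c) ≤ ENNReal.ofReal T := by
  refine iSup₂_le ?_
  rintro _ ⟨φ, ⟨h₁, h₂⟩, rfl⟩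
  obtain ⟨t, ht, htT, hi⟩ := h φ h₁ h₂
  exact (iInf₂_le t ⟨ht, (inspects_iff _ _).2 hi⟩).trans (ENNReal.ofReal_le_ofReal htT)

/-! ### Lower bounds -/

theorem one_sub_two_mul_cos_le {A B : Plane} {φ c : ℝ} (hc : Real.cos c ≤ 0) (hA : 1 ≤ coord A φ)
    (hB : 1 ≤ coord B (φ + c)) : 1 - 2 * Real.cos c ≤ ‖A‖ + dist A B := by
  -- The first leg is projected on the direction opposite to φ - c, the mirror image of φ + c in the
  -- axis φ, so that the transverse terms cancel.
  have h₁ := coord_le_norm A (φ - c + Real.pi)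
  have h₂ := coord_sub_le_dist B A (φ + c)
  rw [coord_add_pi, coord_sub_right] at h₁
  rw [coord_add_right A, dist_comm] at h₂
  nlinarith

theorem one_div_cos_le {A B : Plane} {φ c : ℝ} (hc : 1 / 2 ≤ Real.cos (c / 2)) (hA : 1 ≤ coord A φ)
    (hB : 1 ≤ coord B (φ + c)) : 1 / Real.cos (c / 2) ≤ ‖A‖ + dist A B := by
  have h₁ := coord_le_norm A (φ + c / 2)
  have h₂ := coord_sub_le_dist B A (φ + c)
  have h₃ : coord A (φ + c) + coord A φ = 2 * Real.cos (c / 2) * coord A (φ + c / 2) := by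
    have e₁ : φ + c = φ + c / 2 + c / 2 := by ring
    have e₂ : coord A φ = coord A (φ + c / 2 - c / 2) := by rw [add_sub_cancel_right]
    rw [e₁, e₂, coord_add_right A (φ + c / 2), coord_sub_right]
    ring
  rw [dist_comm] at h₂
  have h₄ := dist_nonneg (x := A) (y := B)
  -- With x = coord A (φ + c) ≤ 1, the bound (1 + x) / (2 cos (c/2)) + 1 - x is nonincreasing in x
  -- because cos (c/2) ≥ 1/2; its value at x = 1 is the claim.
  rw [div_le_iff₀ (by linarith)]
  rcases le_total 1 (coord A (φ + c)) with h | h <;> nlinarith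

/-- Either end of the arc may be inspected first, whence the two signs of d. -/
theorem IsTrajectory.le_of_two_points {γ : ℝ → Plane} (hγ : IsTrajectory γ) {α c τ T : ℝ}
    (hc : 0 ≤ c) (hT : ∀ A B φ d, (d = c ∨ d = -c) → 1 ≤ coord A φ → 1 ≤ coord B (φ + d) →
      T ≤ ‖A‖ + dist A B)
    (h : ∀ φ, α ≤ φ → φ ≤ α + c → ∃ t, 0 ≤ t ∧ t < τ ∧ 1 ≤ coord (γ t) φ) : T ≤ τ := by
  obtain ⟨s, hs₀, hs, hs'⟩ := h α le_rfl (by linarith)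
  obtain ⟨t, ht₀, ht, ht'⟩ := h (α + c) (by linarith) le_rfl
  rcases le_total s t with hst | hst
  · linarith [hT _ _ α c (Or.inl rfl) hs' ht', hγ.norm_le hs₀, hγ.dist_le hs₀ hst]
  · linarith [hT _ _ (α + c) (-c) (Or.inr rfl) ht' (by rwa [add_neg_cancel_right]),
      hγ.norm_le ht₀, hγ.dist_le ht₀ hst]

theorem IsTrajectory.pathLength_map_le {γ : ℝ → Plane} (hγ : IsTrajectory γ) {τ : ℝ} :
    ∀ (l : List ℝ) (a : ℝ), 0 ≤ a → a ≤ τ → (∀ t ∈ l, t ≤ τ) → (a :: l).Pairwise (· ≤ ·) →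
      pathLength ((a :: l).map γ) ≤ τ - a
  | [], a, _, ha, _, _ => by simpa using ha
  | b :: l, a, h0, _, h, hp => by
    have hab : a ≤ b := (List.pairwise_cons.1 hp).1 b (by simp)
    have ih := hγ.pathLength_map_le l b (h0.trans hab) (h b (by simp))
      (fun t ht => h t (by simp [ht])) (List.pairwise_cons.1 hp).2
    have := hγ.dist_le h0 hab
    simp only [List.map_cons, pathLength_cons_cons] at ih ⊢
    linarith

theorem pathLength_map_smul {r : ℝ} (hr : 0 ≤ r) :
    ∀ l : List Plane, pathLength (l.map (r • ·)) = r * pathLength l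
  | [] => by simp [pathLength]
  | [_] => by simp
  | p :: q :: l => by
    have ih := pathLength_map_smul hr (q :: l)
    simp only [List.map_cons, pathLength_cons_cons] at ih ⊢
    rw [ih, dist_smul₀, Real.norm_of_nonneg hr]
    ring

theorem IsTrajectory.lower_bound_of_arc {γ : ℝ → Plane} (hγ : IsTrajectory γ) {α c τ : ℝ}
    (hc : 5 * Real.pi / 6 ≤ c) (hc' : c ≤ 2 * Real.pi)
    (h : ∀ φ, α ≤ φ → φ ≤ α + c → ∃ t, 0 ≤ t ∧ t < τ ∧ 1 ≤ coord (γ t) φ) :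
    1 + Real.sqrt 3 + c - 5 * Real.pi / 6 ≤ τ := by
  classical
  have hpi := Real.pi_pos
  have hτ : 0 < τ := by
    obtain ⟨t, h₀, h₁, -⟩ := h α le_rfl (by linarith)
    linarith
  -- Lowering the threshold from 1 to r makes the inspected sets contain open neighbourhoods, so
  -- finitely many times suffice; dilating by r⁻¹ restores the threshold 1. Finally r tends to 1.
  have key : ∀ r, 0 < r → r < 1 → r * (1 + Real.sqrt 3 + c - 5 * Real.pi / 6) ≤ τ := by
    intro r hr hr₁
    choose! t ht₀ htτ ht using h
    obtain ⟨F, hF, hFcov⟩ := (isCompact_Icc (a := α) (b := α + c)).elim_nhds_subcover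
      (fun φ => {ψ | r < coord (γ (t φ)) ψ}) fun φ hφ =>
        (isOpen_lt continuous_const (continuous_coord _)).mem_nhds
          (show r < coord (γ (t φ)) φ from hr₁.trans_le (ht φ hφ.1 hφ.2))
    have hl : ∀ s ∈ (F.image t).sort (· ≤ ·), 0 ≤ s ∧ s ≤ τ := by
      intro s hs
      rw [Finset.mem_sort, Finset.mem_image] at hs
      obtain ⟨φ, hφ, rfl⟩ := hs
      have := hF φ hφ
      exact ⟨ht₀ φ this.1 this.2, (htτ φ this.1 this.2).le⟩
    have h₁ := hγ.pathLength_map_le ((F.image t).sort (· ≤ ·)) 0 le_rfl hτ.le (fun s hs => (hl s hs).2)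
      (List.pairwise_cons.2 ⟨fun s hs => (hl s hs).1, Finset.pairwise_sort _ _⟩)
    rw [List.map_cons, hγ.start] at h₁
    have h₂ : CoversArc α (α + c) ((((F.image t).sort (· ≤ ·)).map γ).map (r⁻¹ • ·)) := by
      intro φ i₁ i₂
      have := hFcov ⟨i₁, i₂⟩
      simp only [mem_iUnion, mem_ofPred_eq] at this
      obtain ⟨ψ, hψ, hlt⟩ := this
      refine ⟨r⁻¹ • γ (t ψ), ?_, ?_⟩
      · simp only [List.mem_map, Finset.mem_sort, Finset.mem_image]
        exact ⟨_, ⟨_, ⟨ψ, hψ, rfl⟩, rfl⟩, rfl⟩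
      · rw [coord_smul, inv_mul_eq_div, le_div_iff₀ hr, one_mul]
        exact hlt.le
    have h₃ := h₂.lower_bound (by linarith) (by linarith)
    have h₄ := pathLength_map_smul (r := r⁻¹) (by positivity)
      (0 :: ((F.image t).sort (· ≤ ·)).map γ)
    rw [List.map_cons, smul_zero] at h₄
    rw [h₄, add_sub_cancel_left, inv_mul_eq_div, le_div_iff₀ hr] at h₃
    linarith
  by_contra! hlt
  obtain ⟨f, hf⟩ : ∃ f, f = 1 + Real.sqrt 3 + c - 5 * Real.pi / 6 := ⟨_, rfl⟩
  rw [← hf] at key hlt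
  have hf0 : 0 < f := hτ.trans hlt
  have h₁ := key ((τ + f) / (2 * f)) (by positivity) ((div_lt_one (by positivity)).2 (by linarith))
  have h₂ : (τ + f) / (2 * f) * f = (τ + f) / 2 := by field_simp
  linarith

theorem IsTrajectory.optimalTime_le {γ : ℝ → Plane} (hγ : IsTrajectory γ) {α c : ℝ}
    (hc₀ : 0 ≤ c) (hc : c ≤ 2 * Real.pi) :
    ENNReal.ofReal (optimalTime c) ≤ worstCaseTime γ (perimeterArc α c) := by
  have hpi := Real.pi_pos
  refine le_worstCaseTime fun τ h => ?_
  unfold optimalTime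
  split_ifs with h₁ h₂
  · refine hγ.le_of_two_points hc₀ (fun A B φ d hd hA hB => ?_) h
    have hcos : 1 / 2 ≤ Real.cos (c / 2) := by
      rw [← Real.cos_pi_div_three]
      exact Real.cos_le_cos_of_nonneg_of_le_pi (by linarith) (by linarith) (by linarith)
    have hd' : Real.cos (d / 2) = Real.cos (c / 2) := by
      rcases hd with rfl | rfl
      · rfl
      · rw [neg_div, Real.cos_neg]
    rw [← hd'] at hcos ⊢
    exact one_div_cos_le hcos hA hB
  · refine hγ.le_of_two_points hc₀ (fun A B φ d hd hA hB => ?_) h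
    have hcos : Real.cos c ≤ 0 :=
      Real.cos_nonpos_of_pi_div_two_le_of_le (by linarith) (by linarith)
    have hd' : Real.cos d = Real.cos c := by
      rcases hd with rfl | rfl
      · rfl
      · rw [Real.cos_neg]
    rw [← hd'] at hcos ⊢
    exact one_sub_two_mul_cos_le hcos hA hB
  · exact hγ.lower_bound_of_arc (by linarith) hc h

/-! ### Unit-speed curves -/

/-- A cubic defect per step is negligible: n equal steps over a length d lose at most d³/n² in
total. -/
theorem hasUnitSpeedOn_of_dist {f : ℝ → Plane} {s : Set ℝ} (hs : s.OrdConnected)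
    (hup : ∀ a b, a ≤ b → dist (f a) (f b) ≤ b - a)
    (hlow : ∀ a b, a ≤ b → b - a ≤ 1 → (b - a) - (b - a) ^ 3 ≤ dist (f a) (f b)) :
    HasUnitSpeedOn f s := by
  refine hasConstantSpeedOnWith_iff_ordered.2 fun x hx y hy hxy => ?_
  rw [NNReal.coe_one, one_mul]
  apply le_antisymm
  · have hL : LipschitzOnWith 1 f univ := LipschitzOnWith.of_dist_le_mul fun a _ b _ => by
      rw [NNReal.coe_one, one_mul, Real.dist_eq]
      rcases le_total a b with h | h
      · rw [abs_sub_comm, abs_of_nonneg (by linarith)]; exact hup a b h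
      · rw [dist_comm, abs_of_nonneg (by linarith)]; exact hup b a h
    refine (hL.comp_eVariationOn_le (g := id) (mapsTo_univ _ _)).trans ?_
    rw [ENNReal.coe_one, one_mul]
    exact ((monotoneOn_id (s := s)).eVariationOn_eq hx hy).le
  · obtain ⟨d, hd⟩ : ∃ d, d = y - x := ⟨_, rfl⟩
    have hd0 : 0 ≤ d := by linarith
    rw [← hd]
    have hlim : Filter.Tendsto (fun n : ℕ => ENNReal.ofReal (d - d ^ 3 * (1 / (n : ℝ)) ^ 2))
        Filter.atTop (nhds (ENNReal.ofReal d)) := by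
      refine ENNReal.tendsto_ofReal ?_
      have h₁ : Filter.Tendsto (fun n : ℕ => 1 / (n : ℝ)) Filter.atTop (nhds 0) :=
        tendsto_one_div_atTop_nhds_zero_nat
      simpa using ((h₁.pow 2).const_mul (d ^ 3)).const_sub d
    refine le_of_tendsto hlim ?_
    -- For n ≥ d the steps have length at most 1, as the lower bound on chords requires.
    filter_upwards [Filter.eventually_ge_atTop (max 1 ⌈d⌉₊)] with n hn
    have hn₁ : (1 : ℝ) ≤ n := by exact_mod_cast (le_max_left _ _).trans hn
    have hn₂ : d ≤ n := Nat.ceil_le.1 ((le_max_right _ _).trans hn)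
    have hn₀ : (0 : ℝ) < n := by linarith
    have hstep : 0 ≤ d / n := by positivity
    have hsum := eVariationOn.sum_le_of_monotoneOn_Icc (f := f) (s := s ∩ Icc x y) (m := 0) (n := n)
      (u := fun i => x + i * (d / n))
      (fun i _ j _ hij => by dsimp only; gcongr)
      (fun i hi => by
        have h₁ : (i : ℝ) * (d / n) ≤ d := by
          calc (i : ℝ) * (d / n) ≤ n * (d / n) := by gcongr; exact hi.2
            _ = d := by field_simp
        have h₂ : x + i * (d / n) ∈ Icc x y := ⟨by have := mul_nonneg i.cast_nonneg hstep; linarith,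
          by linarith⟩
        exact ⟨hs.out hx hy h₂, h₂⟩)
    refine le_trans ?_ hsum
    have hterm : ∀ i ∈ Finset.Ico 0 n, ENNReal.ofReal (d / n - (d / n) ^ 3) ≤
        edist (f (x + ((i + 1 : ℕ) : ℝ) * (d / n))) (f (x + i * (d / n))) := by
      intro i _
      rw [edist_comm, edist_dist]
      refine ENNReal.ofReal_le_ofReal ?_
      have e : x + ((i + 1 : ℕ) : ℝ) * (d / n) - (x + i * (d / n)) = d / n := by push_cast; ring
      have := hlow (x + i * (d / n)) (x + ((i + 1 : ℕ) : ℝ) * (d / n)) (by linarith)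
        (by rw [e]; exact (div_le_one hn₀).2 hn₂)
      rwa [e] at this
    refine le_trans ?_ (Finset.sum_le_sum hterm)
    rw [Finset.sum_const, Nat.card_Ico, Nat.sub_zero, nsmul_eq_mul, ← ENNReal.ofReal_natCast n,
      ← ENNReal.ofReal_mul (by positivity)]
    refine ENNReal.ofReal_le_ofReal (le_of_eq ?_)
    field_simp

theorem hasUnitSpeedOn_line {s : Set ℝ} (hs : s.OrdConnected) (X u : Plane) (hu : ‖u‖ = 1)
    (a : ℝ) : HasUnitSpeedOn (fun t => X + (t - a) • u) s := by
  have hd : ∀ t t', t ≤ t' → dist (X + (t - a) • u) (X + (t' - a) • u) = t' - t := by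
    intro t t' h
    rw [dist_add_left, dist_eq_norm, ← sub_smul, norm_smul, hu, mul_one, Real.norm_eq_abs,
      abs_sub_comm, abs_of_nonneg (by linarith)]
    ring
  refine hasUnitSpeedOn_of_dist hs (fun t t' h => (hd t t' h).le) fun t t' h _ => ?_
  rw [hd t t' h]
  have : 0 ≤ (t' - t) ^ 3 := pow_nonneg (by linarith) 3
  linarith

theorem dist_perimeterPoint_sq (φ ψ : ℝ) :
    dist (perimeterPoint φ) (perimeterPoint ψ) ^ 2 = (2 * Real.sin ((ψ - φ) / 2)) ^ 2 := by
  rw [dist_sq_eq _ _ φ]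
  simp only [coord_perimeterPoint]
  have e₁ : Real.cos (ψ - φ) = 1 - 2 * Real.sin ((ψ - φ) / 2) ^ 2 := by
    rw [← Real.cos_sq_add_sin_sq ((ψ - φ) / 2), ← sub_eq_zero]
    have := Real.cos_two_mul ((ψ - φ) / 2)
    rw [mul_div_cancel₀ _ two_ne_zero] at this
    rw [this]
    have := Real.cos_sq_add_sin_sq ((ψ - φ) / 2)
    linear_combination this
  have e₂ : Real.cos (φ - (φ + Real.pi / 2)) = 0 := by
    rw [sub_add_cancel_left, Real.cos_neg, Real.cos_pi_div_two]
  have e₃ : Real.cos (ψ - (φ + Real.pi / 2)) = Real.sin (ψ - φ) := by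
    rw [← sub_sub, Real.cos_sub_pi_div_two]
  have e₄ := Real.sin_sq_add_cos_sq (ψ - φ)
  rw [e₂, e₃, sub_self, Real.cos_zero]
  rw [e₁] at e₄ ⊢
  linear_combination e₄

theorem hasUnitSpeedOn_perimeterPoint {s : Set ℝ} (hs : s.OrdConnected) (φ a : ℝ) :
    HasUnitSpeedOn (fun t => perimeterPoint (φ + (t - a))) s := by
  refine hasUnitSpeedOn_of_dist hs (fun t t' h => ?_) fun t t' h h₁ => ?_
  · refine (abs_le_of_sq_le_sq' ?_ (by linarith)).2
    rw [dist_perimeterPoint_sq, sq_le_sq, abs_mul, abs_two]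
    have e : φ + (t' - a) - (φ + (t - a)) = t' - t := by ring
    rw [e]
    have := Real.abs_sin_le_abs (x := (t' - t) / 2)
    rw [abs_div, abs_two] at this
    linarith
  · refine (abs_le_of_sq_le_sq' ?_ dist_nonneg).2
    rw [dist_perimeterPoint_sq]
    have e : φ + (t' - a) - (φ + (t - a)) = t' - t := by ring
    rw [e]
    obtain ⟨δ, hδ⟩ : ∃ δ, δ = t' - t := ⟨_, rfl⟩
    rw [← hδ] at h₁ ⊢
    have h₀ : 0 ≤ δ := by linarith
    have h₂ : 0 ≤ δ ^ 3 := pow_nonneg h₀ 3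
    have h₃ : δ ^ 3 ≤ δ := pow_le_of_le_one h₀ h₁ (by norm_num)
    have h₄ : δ - δ ^ 3 ≤ 2 * Real.sin (δ / 2) := by
      rcases h₀.eq_or_lt with rfl | h₀
      · simp
      · have := Real.sin_gt_sub_cube (x := δ / 2) (by linarith)
        nlinarith
    exact pow_le_pow_left₀ (by linarith) h₄ 2

/-- The curve `f` up to time `T`, the curve `g` afterwards. -/
noncomputable def glue (T : ℝ) (f g : ℝ → Plane) (t : ℝ) : Plane := if t ≤ T then f t else g t

theorem glue_of_le {T t : ℝ} (f g : ℝ → Plane) (h : t ≤ T) : glue T f g t = f t := if_pos h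

theorem glue_of_ge {T t : ℝ} {f g : ℝ → Plane} (hfg : f T = g T) (h : T ≤ t) :
    glue T f g t = g t := by
  rcases h.eq_or_lt with rfl | h
  · rw [glue_of_le _ _ le_rfl, hfg]
  · exact if_neg h.not_ge

theorem hasUnitSpeedOn_mono {f : ℝ → Plane} {s t : Set ℝ} (h : HasUnitSpeedOn f s)
    (hs : s.OrdConnected) (ht : t.OrdConnected) (hts : t ⊆ s) : HasUnitSpeedOn f t :=
  fun x hx y hy => by
    rw [← h (hts hx) (hts hy), inter_eq_self_of_subset_right (ht.out hx hy),
      inter_eq_self_of_subset_right (hs.out (hts hx) (hts hy))]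

theorem hasUnitSpeedOn_congr {f g : ℝ → Plane} {s : Set ℝ} (h : HasUnitSpeedOn f s)
    (hfg : ∀ t ∈ s, g t = f t) : HasUnitSpeedOn g s := fun x hx y hy => by
  rw [← h hx hy]
  exact eVariationOn.congr fun t ht => hfg t ht.1

theorem hasUnitSpeedOn_glue {T : ℝ} {f g : ℝ → Plane} (hT : 0 ≤ T) (hf : HasUnitSpeedOn f (Ici 0))
    (hg : HasUnitSpeedOn g (Ici T)) (hfg : f T = g T) : HasUnitSpeedOn (glue T f g) (Ici 0) := by
  rw [← Icc_union_Ici_eq_Ici hT]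
  refine HasUnitSpeedOn.union
    (hasUnitSpeedOn_congr (hasUnitSpeedOn_mono hf ordConnected_Ici ordConnected_Icc
      Icc_subset_Ici_self) fun t ht => glue_of_le f g ht.2)
    (hasUnitSpeedOn_congr hg fun t ht => glue_of_ge hfg ht) (isGreatest_Icc hT) isLeast_Ici

theorem traversesSegment_of_eq {γ : ℝ → Plane} {s D : ℝ} {X Y u : Plane} (hu : ‖u‖ = 1)
    (hD : 0 ≤ D) (hY : Y = X + D • u) (h : ∀ t, s ≤ t → t ≤ s + D → γ t = X + (t - s) • u) :
    TraversesSegment γ s X Y := by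
  have hXY : dist X Y = D := by
    rw [hY, dist_self_add_right, norm_smul, hu, mul_one, Real.norm_of_nonneg hD]
  rintro t ⟨h₁, h₂⟩
  rw [hXY] at h₂ ⊢
  rw [h t h₁ h₂, AffineMap.lineMap_apply, hY, vsub_eq_sub, vadd_eq_add, add_sub_cancel_left,
    smul_smul, add_comm]
  rcases hD.eq_or_lt with rfl | hD
  · rw [show t = s by linarith]; simp
  · rw [div_mul_cancel₀ _ hD.ne']

/-! ### The optimal trajectories -/

theorem cos_sub_add_pi_div_two (φ : ℝ) : Real.cos (φ - (φ + Real.pi / 2)) = 0 := by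
  rw [sub_add_cancel_left, Real.cos_neg, Real.cos_pi_div_two]

theorem deploymentPoint_eq (α : ℝ) {θ : ℝ} (hθ : Real.cos θ ≠ 0) :
    deploymentPoint α θ = (1 / Real.cos θ) • perimeterPoint (α + θ) := by
  refine ext_coord α ?_ ?_ <;>
    simp only [deploymentPoint, coord_add_left, coord_smul, coord_perimeterPoint]
  · rw [sub_self, Real.cos_zero, add_sub_cancel_left, add_sub_cancel_left, Real.cos_pi_div_two]
    field_simp
    ring
  · rw [cos_sub_add_pi_div_two, sub_self, Real.cos_zero, add_sub_add_left_eq_sub,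
      Real.cos_sub_pi_div_two, Real.tan_eq_sin_div_cos]
    ring

theorem perimeterPoint_eq_deploymentPoint_add (α : ℝ) {θ : ℝ} (hθ : Real.cos θ ≠ 0) :
    perimeterPoint (α + 2 * θ) =
      deploymentPoint α θ + Real.tan θ • perimeterPoint (α + 2 * θ + Real.pi / 2) := by
  rw [deploymentPoint_eq α hθ]
  have e₁ : α + θ - (α + 2 * θ) = -θ := by ring
  have e₂ : α + θ - (α + 2 * θ + Real.pi / 2) = -(θ + Real.pi / 2) := by ring
  have e₃ : α + 2 * θ + Real.pi / 2 - (α + 2 * θ) = Real.pi / 2 := by ring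
  refine ext_coord (α + 2 * θ) ?_ ?_ <;>
    simp only [coord_add_left, coord_smul, coord_perimeterPoint]
  · rw [e₁, e₃, sub_self, Real.cos_zero, Real.cos_neg, Real.cos_pi_div_two]
    field_simp
    ring
  · rw [e₂, cos_sub_add_pi_div_two, Real.cos_neg, Real.cos_add_pi_div_two, sub_self, Real.cos_zero,
      Real.tan_eq_sin_div_cos]
    ring

theorem one_le_coord_deploymentPoint {α θ φ : ℝ} (h₀ : 0 ≤ θ) (h₁ : θ < Real.pi / 2) (h₂ : α ≤ φ)
    (h₃ : φ ≤ α + 2 * θ) : 1 ≤ coord (deploymentPoint α θ) φ := by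
  have hcos : 0 < Real.cos θ := Real.cos_pos_of_mem_Ioo ⟨by linarith, h₁⟩
  rw [deploymentPoint_eq α hcos.ne', coord_smul, coord_perimeterPoint, one_div_mul_eq_div,
    le_div_iff₀ hcos, one_mul, ← Real.cos_abs (α + θ - φ)]
  exact Real.cos_le_cos_of_nonneg_of_le_pi (abs_nonneg _) (by linarith)
    (abs_le.2 ⟨by linarith, by linarith⟩)

/-- The deployment point inspects [α, α + 2θ]. Along the perpendicular the coordinate at α + 2θ does
not decrease, since c - 2θ ≤ π/2, so the foot inspects the rest. -/
theorem exists_isType1Curve (α : ℝ) {c θ : ℝ} (h₀ : 0 ≤ θ)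
    (h₁ : θ < Real.pi / 2) (h₂ : θ ≤ c / 2) (h₃ : c - Real.pi / 2 ≤ 2 * θ) :
    ∃ γ, IsTrajectory γ ∧ IsType1Curve α c θ γ ∧ ∀ φ, α ≤ φ → φ ≤ α + c →
      ∃ t, 0 ≤ t ∧ t ≤ 1 / Real.cos θ + (1 - Real.cos (c - θ) / Real.cos θ) ∧
        1 ≤ coord (γ t) φ := by
  have hpi := Real.pi_pos
  have hcos : 0 < Real.cos θ := Real.cos_pos_of_mem_Ioo ⟨by linarith, h₁⟩
  obtain ⟨A, hA⟩ : ∃ A, A = deploymentPoint α θ := ⟨_, rfl⟩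
  have hA' := hA.trans (deploymentPoint_eq α hcos.ne')
  obtain ⟨d, hd⟩ : ∃ d, d = 1 / Real.cos θ := ⟨_, rfl⟩
  have hd0 : 0 < d := by rw [hd]; positivity
  obtain ⟨D, hD⟩ : ∃ D, D = 1 - Real.cos (c - θ) / Real.cos θ := ⟨_, rfl⟩
  have hcA : coord A (α + c) = 1 - D := by
    rw [hA', hD, coord_smul, coord_perimeterPoint, add_sub_add_left_eq_sub, ← Real.cos_neg (θ - c),
      neg_sub]
    ring
  have hD0 : 0 ≤ D := by
    rw [hD, sub_nonneg, div_le_one hcos]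
    exact Real.cos_le_cos_of_nonneg_of_le_pi h₀ (by linarith) (by linarith)
  rw [← hd] at hA'
  rw [← hd, ← hD]
  have hdist : dist 0 A = d := by
    rw [dist_zero_left, hA', norm_smul, norm_perimeterPoint, mul_one, Real.norm_of_nonneg hd0.le]
  have hfoot : tangentFoot (α + c) A = A + D • perimeterPoint (α + c) := by
    rw [tangentFoot, inner_perimeterPoint, hcA, sub_sub_cancel]
  let f : ℝ → Plane := fun t => 0 + (t - 0) • perimeterPoint (α + θ)
  let g : ℝ → Plane := fun t => A + (t - d) • perimeterPoint (α + c)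
  have hfg : f d = g d := by simp [f, g, hA']
  have hg : ∀ t, d ≤ t → glue d f g t = A + (t - d) • perimeterPoint (α + c) :=
    fun t ht => glue_of_ge hfg ht
  refine ⟨glue d f g, ⟨?_, ?_⟩, ⟨h₀, h₁, h₂, h₃, ?_, ?_⟩, fun φ hφ hφ' => ?_⟩
  · rw [glue_of_le _ _ hd0.le]; simp [f]
  · exact hasUnitSpeedOn_glue hd0.le
      (hasUnitSpeedOn_line ordConnected_Ici _ _ (norm_perimeterPoint _) _)
      (hasUnitSpeedOn_line ordConnected_Ici _ _ (norm_perimeterPoint _) _) hfg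
  · rw [← hA]
    exact traversesSegment_of_eq (norm_perimeterPoint (α + θ)) hd0.le (by rw [hA', zero_add])
      fun t _ ht => glue_of_le _ _ (by linarith)
  · rw [← hA, hdist]
    exact traversesSegment_of_eq (norm_perimeterPoint (α + c)) hD0 hfoot fun t ht _ => hg t ht
  · rcases le_total φ (α + 2 * θ) with h | h
    · refine ⟨d, hd0.le, by linarith, ?_⟩
      rw [hg d le_rfl, sub_self, zero_smul, add_zero, hA]
      exact one_le_coord_deploymentPoint h₀ h₁ hφ h
    · refine ⟨d + D, by linarith, le_rfl, ?_⟩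
      rw [hg _ (by linarith), add_sub_cancel_left]
      refine covers_of_lt_pi (a := α + 2 * θ) (e := α + c) (by linarith) ?_ ?_ φ h hφ'
      · have i₁ : 1 ≤ coord A (α + 2 * θ) := by
          rw [hA]; exact one_le_coord_deploymentPoint h₀ h₁ (by linarith) le_rfl
        have i₂ : 0 ≤ Real.cos (α + c - (α + 2 * θ)) :=
          Real.cos_nonneg_of_mem_Icc ⟨by linarith, by linarith⟩
        rw [coord_add_left, coord_smul, coord_perimeterPoint]
        linarith [mul_nonneg hD0 i₂]
      · rw [coord_add_left, coord_smul, coord_perimeterPoint, hcA, sub_self, Real.cos_zero]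
        linarith

/-- The deployment point inspects [α, α + 2θ], each point of the arc is inspected on passing it, and
the foot of the final unit perpendicular inspects the last quarter turn. -/
theorem exists_isType2Curve (α : ℝ) {c θ : ℝ} (h₀ : 0 ≤ θ)
    (h₁ : θ < Real.pi / 2) (h₂ : 2 * θ ≤ c - Real.pi / 2) :
    ∃ γ, IsTrajectory γ ∧ IsType2Curve α c θ γ ∧ ∀ φ, α ≤ φ → φ ≤ α + c →
      ∃ t, 0 ≤ t ∧ t ≤ 1 / Real.cos θ + Real.tan θ + (c - Real.pi / 2 - 2 * θ) + 1 ∧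
        1 ≤ coord (γ t) φ := by
  have hpi := Real.pi_pos
  have hcos : 0 < Real.cos θ := Real.cos_pos_of_mem_Ioo ⟨by linarith, h₁⟩
  have htan : 0 ≤ Real.tan θ := Real.tan_nonneg_of_nonneg_of_le_pi_div_two h₀ h₁.le
  obtain ⟨A, hA⟩ : ∃ A, A = deploymentPoint α θ := ⟨_, rfl⟩
  have hA' := hA.trans (deploymentPoint_eq α hcos.ne')
  have hAP := perimeterPoint_eq_deploymentPoint_add α hcos.ne'
  rw [← hA] at hAP
  obtain ⟨d, hd⟩ : ∃ d, d = 1 / Real.cos θ := ⟨_, rfl⟩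
  have hd0 : 0 < d := by rw [hd]; positivity
  rw [← hd] at hA' ⊢
  obtain ⟨e, he⟩ : ∃ e, e = d + Real.tan θ := ⟨_, rfl⟩
  obtain ⟨l, hl⟩ : ∃ l, l = e + (c - Real.pi / 2 - 2 * θ) := ⟨_, rfl⟩
  rw [← he, ← hl]
  have hde : d ≤ e := by linarith
  have hel : e ≤ l := by linarith
  have hdist : dist 0 A = d := by
    rw [dist_zero_left, hA', norm_smul, norm_perimeterPoint, mul_one, Real.norm_of_nonneg hd0.le]
  have hdist' : dist A (perimeterPoint (α + 2 * θ)) = Real.tan θ := by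
    rw [hAP, dist_self_add_right, norm_smul, norm_perimeterPoint, mul_one, Real.norm_of_nonneg htan]
  have hright : α + c - (α + c - Real.pi / 2) = Real.pi / 2 := by ring
  have hright' : α + c - Real.pi / 2 - (α + c) = -(Real.pi / 2) := by ring
  have hfoot : tangentFoot (α + c) (perimeterPoint (α + c - Real.pi / 2)) =
      perimeterPoint (α + c - Real.pi / 2) + (1 : ℝ) • perimeterPoint (α + c) := by
    rw [tangentFoot, inner_perimeterPoint, coord_perimeterPoint, hright', Real.cos_neg,
      Real.cos_pi_div_two, sub_zero]
  let f₁ : ℝ → Plane := fun t => 0 + (t - 0) • perimeterPoint (α + θ)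
  let f₂ : ℝ → Plane := fun t => A + (t - d) • perimeterPoint (α + 2 * θ + Real.pi / 2)
  let f₃ : ℝ → Plane := fun t => perimeterPoint (α + 2 * θ + (t - e))
  let f₄ : ℝ → Plane := fun t => perimeterPoint (α + c - Real.pi / 2) +
    (t - l) • perimeterPoint (α + c)
  have h₁₂ : f₁ d = f₂ d := by simp [f₁, f₂, hA']
  have h₂₃ : glue d f₁ f₂ e = f₃ e := by
    rw [glue_of_ge h₁₂ hde]
    simp only [f₂, f₃]
    rw [sub_self, add_zero, hAP, he, add_sub_cancel_left]
  have h₃₄ : glue e (glue d f₁ f₂) f₃ l = f₄ l := by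
    rw [glue_of_ge h₂₃ hel]
    simp only [f₃, f₄]
    rw [sub_self, zero_smul, add_zero, hl]
    congr 1
    ring
  obtain ⟨γ, hγ⟩ : ∃ γ, γ = glue l (glue e (glue d f₁ f₂) f₃) f₄ := ⟨_, rfl⟩
  have g₁ : ∀ t, t ≤ d → γ t = f₁ t := fun t ht => by
    rw [hγ, glue_of_le _ _ (by linarith), glue_of_le _ _ (by linarith), glue_of_le _ _ ht]
  have g₂ : ∀ t, d ≤ t → t ≤ e → γ t = f₂ t := fun t ht ht' => by
    rw [hγ, glue_of_le _ _ (by linarith), glue_of_le _ _ ht', glue_of_ge h₁₂ ht]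
  have g₃ : ∀ t, e ≤ t → t ≤ l → γ t = f₃ t := fun t ht ht' => by
    rw [hγ, glue_of_le _ _ ht', glue_of_ge h₂₃ ht]
  have g₄ : ∀ t, l ≤ t → γ t = f₄ t := fun t ht => by
    rw [hγ, glue_of_ge h₃₄ ht]
  refine ⟨γ, ⟨?_, ?_⟩, ⟨h₀, h₁, h₂, ?_, ?_, ?_, ?_⟩, fun φ hφ hφ' => ?_⟩
  · rw [g₁ _ hd0.le]; simp [f₁]
  · rw [hγ]
    refine hasUnitSpeedOn_glue (by linarith) (hasUnitSpeedOn_glue (by linarith)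
      (hasUnitSpeedOn_glue hd0.le ?_ ?_ h₁₂) ?_ h₂₃) ?_ h₃₄
    · exact hasUnitSpeedOn_line ordConnected_Ici _ _ (norm_perimeterPoint _) _
    · exact hasUnitSpeedOn_line ordConnected_Ici _ _ (norm_perimeterPoint _) _
    · exact hasUnitSpeedOn_perimeterPoint ordConnected_Ici _ _
    · exact hasUnitSpeedOn_line ordConnected_Ici _ _ (norm_perimeterPoint _) _
  · rw [← hA]
    exact traversesSegment_of_eq (norm_perimeterPoint (α + θ)) hd0.le (by rw [hA', zero_add])
      fun t _ ht => g₁ t (by linarith)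
  · rw [← hA, hdist]
    exact traversesSegment_of_eq (norm_perimeterPoint _) htan hAP
      fun t ht ht' => g₂ t ht (by linarith)
  · rw [← hA, hdist, hdist', ← he]
    rintro t ⟨ht, ht'⟩
    exact g₃ t ht (by linarith)
  · rw [← hA, hdist, hdist', ← he, ← hl]
    exact traversesSegment_of_eq (norm_perimeterPoint (α + c)) zero_le_one hfoot
      fun t ht _ => g₄ t ht
  · rcases le_total φ (α + 2 * θ) with h | h
    · refine ⟨d, hd0.le, by linarith, ?_⟩
      rw [g₂ d le_rfl hde]
      simp only [f₂]
      rw [sub_self, zero_smul, add_zero, hA]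
      exact one_le_coord_deploymentPoint h₀ h₁ hφ h
    rcases le_total φ (α + c - Real.pi / 2) with h' | h'
    · refine ⟨e + (φ - (α + 2 * θ)), by linarith, by linarith, ?_⟩
      rw [g₃ _ (by linarith) (by linarith)]
      simp only [f₃]
      rw [add_sub_cancel_left, add_sub_cancel, coord_perimeterPoint, sub_self, Real.cos_zero]
    · refine ⟨l + 1, by linarith, le_rfl, ?_⟩
      rw [g₄ _ (by linarith)]
      simp only [f₄]
      rw [add_sub_cancel_left, one_smul]
      refine covers_of_lt_pi (a := α + c - Real.pi / 2) (e := α + c) (by linarith) ?_ ?_ φ h' hφ'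
      · rw [coord_add_left, coord_perimeterPoint, coord_perimeterPoint, sub_self, Real.cos_zero,
          hright, Real.cos_pi_div_two, add_zero]
      · rw [coord_add_left, coord_perimeterPoint, coord_perimeterPoint, sub_self, Real.cos_zero,
          hright', Real.cos_neg, Real.cos_pi_div_two, zero_add]

theorem inspectsAll_of_forall {γ : ℝ → Plane} {α c T : ℝ}
    (h : ∀ φ, α ≤ φ → φ ≤ α + c → ∃ t, 0 ≤ t ∧ t ≤ T ∧ 1 ≤ coord (γ t) φ) :
    InspectsAll γ (perimeterArc α c) := by
  rintro _ ⟨φ, ⟨h₁, h₂⟩, rfl⟩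
  obtain ⟨t, ht, -, hi⟩ := h φ h₁ h₂
  exact ⟨t, ht, (inspects_iff _ _).2 hi⟩

theorem exists_optimal_isType1Curve (α : ℝ) {c : ℝ} (hc₀ : 0 ≤ c) (hc : c ≤ 5 * Real.pi / 6) :
    ∃ (θ : ℝ) (γ : ℝ → Plane), IsTrajectory γ ∧ InspectsAll γ (perimeterArc α c) ∧
      IsType1Curve α c θ γ ∧
      worstCaseTime γ (perimeterArc α c) = ENNReal.ofReal (optimalTime c) := by
  have hpi := Real.pi_pos
  -- The length 1/cos θ + 1 - cos c - sin c tan θ is stationary where sin θ = sin c, hence θ = π -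
  -- c. This satisfies θ ≤ c/2 only from c = 2π/3 on; below that the boundary value c/2 is used and
  -- the perpendicular has length 0.
  obtain ⟨θ, h₀, h₁, h₂, h₃, hT⟩ : ∃ θ, 0 ≤ θ ∧ θ < Real.pi / 2 ∧ θ ≤ c / 2 ∧
      c - Real.pi / 2 ≤ 2 * θ ∧
      1 / Real.cos θ + (1 - Real.cos (c - θ) / Real.cos θ) = optimalTime c := by
    unfold optimalTime
    split_ifs with h
    · refine ⟨c / 2, by linarith, by linarith, le_rfl, by linarith, ?_⟩
      have hcos : 0 < Real.cos (c / 2) := Real.cos_pos_of_mem_Ioo ⟨by linarith, by linarith⟩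
      rw [sub_half, div_self hcos.ne']
      ring
    · refine ⟨Real.pi - c, by linarith, by linarith, by linarith, by linarith, ?_⟩
      have hcos : Real.cos c < 0 :=
        Real.cos_neg_of_pi_div_two_lt_of_lt (by linarith) (by linarith)
      have e : c - (Real.pi - c) = 2 * c - Real.pi := by ring
      rw [Real.cos_pi_sub, e, Real.cos_sub_pi, Real.cos_two_mul]
      have hne := hcos.ne
      field_simp
      ring
  obtain ⟨γ, hγ, hγ₁, hγ₂⟩ := exists_isType1Curve α h₀ h₁ h₂ h₃
  rw [hT] at hγ₂
  exact ⟨θ, γ, hγ, inspectsAll_of_forall hγ₂, hγ₁,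
    le_antisymm (worstCaseTime_le hγ₂) (hγ.optimalTime_le hc₀ (by linarith))⟩

theorem exists_optimal_isType2Curve (α : ℝ) {c : ℝ} (hc : 5 * Real.pi / 6 < c)
    (hc' : c ≤ 2 * Real.pi) :
    ∃ (θ : ℝ) (γ : ℝ → Plane), IsTrajectory γ ∧ InspectsAll γ (perimeterArc α c) ∧
      IsType2Curve α c θ γ ∧
      worstCaseTime γ (perimeterArc α c) = ENNReal.ofReal (optimalTime c) := by
  have hpi := Real.pi_pos
  have hT : 1 / Real.cos (Real.pi / 6) + Real.tan (Real.pi / 6) +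
      (c - Real.pi / 2 - 2 * (Real.pi / 6)) + 1 = optimalTime c := by
    rw [optimalTime, if_neg (by linarith), if_neg (by linarith), Real.cos_pi_div_six,
      Real.tan_pi_div_six]
    have h : 1 / (Real.sqrt 3 / 2) + 1 / Real.sqrt 3 = Real.sqrt 3 := by
      have h₁ : Real.sqrt 3 * Real.sqrt 3 = 3 := Real.mul_self_sqrt (by norm_num)
      have h₂ : Real.sqrt 3 ≠ 0 := by positivity
      field_simp
      linarith
    rw [h]
    ring
  -- The angle π/6 minimises 1/cos θ + tan θ - 2θ: the derivative vanishes where sin θ = 1/2.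
  obtain ⟨γ, hγ, hγ₁, hγ₂⟩ := exists_isType2Curve α (c := c) (θ := Real.pi / 6) (by linarith)
    (by linarith) (by linarith)
  rw [hT] at hγ₂
  exact ⟨_, γ, hγ, inspectsAll_of_forall hγ₂, hγ₁,
    le_antisymm (worstCaseTime_le hγ₂) (hγ.optimalTime_le (by linarith) hc')⟩

end DiskInspection

theorem theorem1 (α c : ℝ) (hc₀ : 0 ≤ c) (hc : c ≤ 2 * Real.pi) :
    IsLeast (DiskInspection.worstCaseTimes (DiskInspection.perimeterArc α c))
      (ENNReal.ofReal (DiskInspection.optimalTime c)) ∧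
    (c ≤ 5 * Real.pi / 6 →
      ∃ (θ : ℝ) (γ : ℝ → DiskInspection.Plane),
        DiskInspection.IsTrajectory γ ∧
        DiskInspection.InspectsAll γ (DiskInspection.perimeterArc α c) ∧
        DiskInspection.IsType1Curve α c θ γ ∧
        DiskInspection.worstCaseTime γ (DiskInspection.perimeterArc α c) =
          ENNReal.ofReal (DiskInspection.optimalTime c)) ∧
    (5 * Real.pi / 6 < c →
      ∃ (θ : ℝ) (γ : ℝ → DiskInspection.Plane),
        DiskInspection.IsTrajectory γ ∧
        DiskInspection.InspectsAll γ (DiskInspection.perimeterArc α c) ∧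
        DiskInspection.IsType2Curve α c θ γ ∧
        DiskInspection.worstCaseTime γ (DiskInspection.perimeterArc α c) =
          ENNReal.ofReal (DiskInspection.optimalTime c)) := by
  refine ⟨⟨?_, ?_⟩, DiskInspection.exists_optimal_isType1Curve α hc₀,
    fun h => DiskInspection.exists_optimal_isType2Curve α h hc⟩
  · rcases le_or_gt c (5 * Real.pi / 6) with h | h
    · obtain ⟨-, γ, h₁, h₂, -, h₃⟩ := DiskInspection.exists_optimal_isType1Curve α hc₀ h
      exact ⟨γ, h₁, h₂, h₃⟩
    · obtain ⟨-, γ, h₁, h₂, -, h₃⟩ := DiskInspection.exists_optimal_isType2Curve α h hc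
      exact ⟨γ, h₁, h₂, h₃⟩
  · rintro _ ⟨γ, hγ, -, rfl⟩
    exact hγ.optimalTime_le hc₀ hc
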